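/- A closed hyperbolic surface is a compact quotient $X=\Gamma\backslash\mathbb H$ of the hyperbolic plane by a subgroup $\Gamma\le \mathrm{PSL}_2(\mathbb R)$ acting freely and properly discontinuously, with the induced metric and area $\operatorname{vol}$. For $R>0$ let $N_s(X,R)$ be the number of (unoriented) simple closed geodesics on $X$ of length $\le R$, and let $$X_{<R}=\{p\in X : \operatorname{InjRad}(p)<R\},\qquad \operatorname{InjRad}(p)=\sup\{r : \exp_p \text{ is injective on } B_r(0)\subseteq T_pX\}.$$ \textbf{Proposition.} Let $(X_n)_{n\in\mathbb N}$ be a sequence of closed hyperbolic surfaces. If for every $R>0$ $$\frac{N_s(X_n,R)}{\operatorname{vol}(X_n)}\xrightarrow[n\to\infty]{}0,$$ then $(X_n)_{n\in\mathbb N}$ is Benjamini--Schramm convergent to $\mathbb H$, that is, for every $R>0$ $$\frac{\operatorname{vol}\big((X_n)_{<R}\big)}{\operatorname{vol}(X_n)}\xrightarrow[n\to\infty]{}0.$$ -/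

import Mathlib

open MeasureTheory Filter Topology
open scoped UpperHalfPlane MatrixGroups ENNReal NNReal

noncomputable section

namespace HyperbolicSurface

/-- The centre of `SL(2, ℝ)` acts trivially on the upper half-plane. -/
theorem center_smul {g : SL(2, ℝ)} (hg : g ∈ Subgroup.center SL(2, ℝ)) (z : ℍ) : g • z = z := by
  have h := Matrix.SpecialLinearGroup.scalar_eq_self_of_mem_center hg 0
  have h01 : g 0 1 = 0 := by
    have := congrFun (congrFun h 0) 1
    simpa using this.symm
  have h10 : g 1 0 = 0 := by
    have := congrFun (congrFun h 1) 0
    simpa using this.symm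
  have h11 : g 1 1 = g 0 0 := by
    have := congrFun (congrFun h 1) 1
    simpa using this.symm
  have hdet : g 0 0 * g 0 0 = 1 := by
    have := g.det_coe
    rw [Matrix.det_fin_two, h01, h10, h11] at this
    simpa using this
  have h00 : ((g 0 0 : ℝ) : ℂ) ≠ 0 := by
    intro h0
    have h0' : g 0 0 = 0 := by exact_mod_cast h0
    rw [h0'] at hdet
    norm_num at hdet
  apply UpperHalfPlane.ext
  rw [UpperHalfPlane.coe_specialLinearGroup_apply]
  simp only [h01, h10, h11, Algebra.algebraMap_self, RingHom.id_apply, Complex.ofReal_zero,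
    add_zero, zero_mul, zero_add]
  field_simp

/-- The action of `PSL(2, ℝ)` on the upper half-plane by Möbius transformations. -/
def pslToPerm : PSL(2, ℝ) →* Equiv.Perm ℍ :=
  QuotientGroup.lift (Subgroup.center SL(2, ℝ)) (MulAction.toPermHom SL(2, ℝ) ℍ)
    fun _ hg => Equiv.ext fun z => center_smul hg z

instance pslAction : MulAction PSL(2, ℝ) ℍ := MulAction.compHom ℍ pslToPerm

theorem psl_mk_smul (g : SL(2, ℝ)) (z : ℍ) : (QuotientGroup.mk g : PSL(2, ℝ)) • z = g • z := rfl

/-- The point `ζ = -i tanh(|v| / (2 Im z)) v / |v|` of the unit disc (`0` if `v = 0`). -/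
def discPoint (z : ℍ) (v : ℂ) : ℂ :=
  -Complex.I * ((Real.tanh (‖v‖ / (2 * z.im)) : ℝ) : ℂ) * (v / (‖v‖ : ℂ))

theorem norm_discPoint_lt_one (z : ℍ) (v : ℂ) : ‖discPoint z v‖ < 1 := by
  have h1 : ‖v / (‖v‖ : ℂ)‖ ≤ 1 := by
    rw [norm_div, Complex.norm_real, norm_norm]
    exact div_self_le_one _
  have h2 : |Real.tanh (‖v‖ / (2 * z.im))| < 1 := Real.abs_tanh_lt_one _
  unfold discPoint
  rw [norm_mul, norm_mul, norm_neg, Complex.norm_I, one_mul, Complex.norm_real, Real.norm_eq_abs]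
  calc _ ≤ |Real.tanh (‖v‖ / (2 * z.im))| * 1 := by gcongr
    _ < 1 := by rwa [mul_one]

theorem im_cayley_pos {ζ : ℂ} (h : ‖ζ‖ < 1) : 0 < (Complex.I * (1 + ζ) / (1 - ζ)).im := by
  have hne : 1 - ζ ≠ 0 := by
    intro h0
    rw [← sub_eq_zero.mp h0] at h
    simp at h
  have hpos : 0 < Complex.normSq (1 - ζ) := Complex.normSq_pos.mpr hne
  have hsq : ζ.re * ζ.re + ζ.im * ζ.im < 1 := by
    rw [← Complex.normSq_apply, Complex.normSq_eq_norm_sq]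
    nlinarith [norm_nonneg ζ]
  rw [Complex.div_im, ← sub_div]
  apply div_pos _ hpos
  simp
  nlinarith

theorem im_exp_pos (z : ℍ) (v : ℂ) :
    0 < ((z.re : ℂ) + (z.im : ℂ) *
      (Complex.I * (1 + discPoint z v) / (1 - discPoint z v))).im := by
  rw [Complex.add_im, Complex.ofReal_im, Complex.im_ofReal_mul, zero_add]
  exact mul_pos z.im_pos (im_cayley_pos (norm_discPoint_lt_one z v))

/-- The Riemannian exponential map `exp_z : T_z ℍ → ℍ` of the hyperbolic plane. The tangent space
at `z` is `ℂ`, with the norm `|v| / Im z` of the metric `(dx² + dy²) / y²`.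
In the unit disc the geodesic of initial unit direction `u` at `0` is `r ↦ tanh(r / 2) u`;
the Cayley transform `ζ ↦ i (1 + ζ) / (1 - ζ)` carries it (its differential at `0` being
multiplication by `2i`) to a geodesic at `i`, and `w ↦ Re z + (Im z) w` carries that one to `z`. -/
def hexp (z : ℍ) (v : ℂ) : ℍ :=
  ⟨(z.re : ℂ) + (z.im : ℂ) * (Complex.I * (1 + discPoint z v) / (1 - discPoint z v)),
    im_exp_pos z v⟩

/-- The open ball of radius `r` about the origin of the tangent space `T_z ℍ`. -/
def tangentBall (z : ℍ) (r : ℝ) : Set ℂ := {v | ‖v‖ / z.im < r}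

end HyperbolicSurface

open HyperbolicSurface

/-- A closed hyperbolic surface `Γ \ ℍ`: the compact quotient of the hyperbolic plane by a group
`Γ` of orientation-preserving isometries that acts freely and properly discontinuously. -/
structure ClosedHyperbolicSurface where
  /-- The Fuchsian group. -/
  Γ : Subgroup PSL(2, ℝ)
  properlyDiscontinuous : ProperlyDiscontinuousSMul Γ ℍ
  free : ∀ γ ∈ Γ, ∀ z : ℍ, γ • z = z → γ = 1
  compact : CompactSpace (MulAction.orbitRel.Quotient Γ ℍ)

namespace ClosedHyperbolicSurface

variable (X : ClosedHyperbolicSurface)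

/-- The points of the surface. -/
abbrev Point : Type := MulAction.orbitRel.Quotient X.Γ ℍ

/-- The universal covering `ℍ → Γ \ ℍ`. -/
def proj (z : ℍ) : X.Point := Quotient.mk _ z

/-- The Dirichlet fundamental domain of `Γ` centred at `i`. -/
def dirichletDomain : Set ℍ :=
  {z | ∀ γ ∈ X.Γ, dist z UpperHalfPlane.I ≤ dist z (γ • UpperHalfPlane.I)}

/-- The hyperbolic area of a subset of the surface. -/
def vol (A : Set X.Point) : ℝ≥0∞ := volume (X.dirichletDomain ∩ X.proj ⁻¹' A)

/-- `InjRad(p)`, the supremum of the radii `r` such that `exp_p` is injective on the ball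
`B_r(0) ⊆ T_p X`. As the covering is a local isometry, `T_p X` is `T_z ℍ` and `exp_p` is
`exp_z` followed by the covering, for any point `z` above `p`. -/
def injRad (p : X.Point) : ℝ≥0∞ :=
  ⨆ (r : ℝ≥0) (_ : ∃ z : ℍ, X.proj z = p ∧
    Set.InjOn (fun v => X.proj (hexp z v)) (tangentBall z r)), (r : ℝ≥0∞)

/-- The `R`-thin part of the surface. -/
def thinPart (R : ℝ) : Set X.Point := {p | X.injRad p < ENNReal.ofReal R}

/-- `A` is (the trace of) a simple closed geodesic of length `L`. The complete unit speed geodesics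
of the surface are the projections of those of `ℍ`, which are the isometric embeddings of `ℝ`.
Such a geodesic is closed of length `L` if it is `L`-periodic, and simple if it has no
self-intersection within a period. -/
def IsSimpleClosedGeodesic (A : Set X.Point) (L : ℝ) : Prop :=
  0 < L ∧ ∃ c : ℝ → ℍ, Isometry c ∧ (∀ t, X.proj (c (t + L)) = X.proj (c t)) ∧
    Set.InjOn (fun t => X.proj (c t)) (Set.Ico 0 L) ∧ A = Set.range fun t => X.proj (c t)

/-- The number `N_s(X, R)` of simple closed geodesics of length at most `R`, unoriented and up to
reparametrization, that is, counted by their traces. -/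
def numSimpleClosedGeodesics (R : ℝ) : ℕ∞ :=
  {A : Set X.Point | ∃ L ≤ R, X.IsSimpleClosedGeodesic A L}.encard

end ClosedHyperbolicSurface

/-- Benjamini–Schramm convergence of a sequence of closed hyperbolic surfaces to `ℍ`. -/
def BenjaminiSchrammConvergent (X : ℕ → ClosedHyperbolicSurface) : Prop :=
  ∀ R : ℝ, 0 < R →
    Tendsto (fun n => (X n).vol ((X n).thinPart R) / (X n).vol Set.univ) atTop (𝓝 0)

end

noncomputable section

/-! ### Geodesic arcs and the broken geodesic of an orbit -/

namespace HyperbolicSurface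

/-! The heart is the bound vol(X_{<R}) ≤ C(R) · N_s(X, 2R) with C(R) independent of X
(`vol_thinPart_le`); dividing by vol(X) gives the theorem.

If z lies over the thin part, some nontrivial γ ∈ Γ moves z by less than 2R. Let γ be the one of
least displacement at z. By compactness all displacements are bounded below, so γ is hyperbolic, and
its axis projects to a closed geodesic no longer than 2R. This geodesic is simple
(`eq_of_smul_iexp_eq`). Make the axis imaginary, so that γ becomes a dilation D, and join the points
D^k z by geodesic segments. If some g ∈ Γ carried the axis across itself, it would carry this broken
line across itself too. Cutting and pasting at the crossing yields four nontrivial elements, and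
minimality forces the crossing to be the common midpoint of two segments, hence a fixed point, which
freeness forbids. So a g sending a point of the axis into the axis preserves the axis: it is either
a dilation, shorter than D only if trivial, or a half-turn, which freeness excludes.

The thin part is therefore covered by collars, one for each simple closed geodesic of length at most
2R. A collar around a geodesic of length l has width factor of order 1/l and length l, so its area
is bounded in terms of R alone (`volume_dirichletDomain_inter_collar_le`). -/

theorem dist_eq_abs_of_cosh {z w : ℍ} {u : ℝ} (h : Real.cosh (dist z w) = Real.cosh u) :
    dist z w = |u| := by
  have h1 := Real.cosh_le_cosh.mp h.le
  have h2 := Real.cosh_le_cosh.mp h.ge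
  rw [abs_of_nonneg dist_nonneg] at h1 h2
  exact le_antisymm h1 h2

theorem mem_Ioo_of_mem_circle {m ρ : ℝ} (hρ : 0 < ρ) {z : ℍ}
    (hz : (z.re - m) ^ 2 + z.im ^ 2 = ρ ^ 2) : (z.re - m) / ρ ∈ Set.Ioo (-1 : ℝ) 1 := by
  have hy := z.im_pos
  rw [Set.mem_Ioo, ← abs_lt, ← sq_lt_one_iff_abs_lt_one, div_pow, div_lt_one (by positivity)]
  have : 0 < z.im ^ 2 := by positivity
  linarith

/-- The distance of two points of a half-circle orthogonal to the real line. -/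
theorem dist_eq_of_mem_circle {m ρ : ℝ} (hρ : 0 < ρ) {z w : ℍ}
    (hz : (z.re - m) ^ 2 + z.im ^ 2 = ρ ^ 2) (hw : (w.re - m) ^ 2 + w.im ^ 2 = ρ ^ 2) :
    dist z w = |Real.artanh ((z.re - m) / ρ) - Real.artanh ((w.re - m) / ρ)| := by
  have key : ∀ z : ℍ, (z.re - m) ^ 2 + z.im ^ 2 = ρ ^ 2 →
      Real.cosh (Real.artanh ((z.re - m) / ρ)) = ρ / z.im ∧
      Real.sinh (Real.artanh ((z.re - m) / ρ)) = (z.re - m) / z.im := by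
    intro z hz
    have hy := z.im_pos
    have hs : 1 - ((z.re - m) / ρ) ^ 2 = (z.im / ρ) ^ 2 := by
      field_simp
      linarith
    have hmem := mem_Ioo_of_mem_circle hρ hz
    have hq : √(1 - ((z.re - m) / ρ) ^ 2) = z.im / ρ := by
      rw [hs]; exact Real.sqrt_sq (by positivity)
    rw [Real.cosh_artanh hmem, Real.sinh_artanh hmem, hq]
    constructor <;> field_simp
  obtain ⟨hcz, hsz⟩ := key z hz
  obtain ⟨hcw, hsw⟩ := key w hw
  apply dist_eq_abs_of_cosh
  rw [Real.cosh_sub, hcz, hsz, hcw, hsw, UpperHalfPlane.cosh_dist']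
  have hy := z.im_pos
  have hy' := w.im_pos
  field_simp
  linarith

/-- Distances add up along a half-circle orthogonal to the real line. -/
theorem dist_add_dist_of_mem_circle {m ρ : ℝ} (hρ : 0 < ρ) {u v w : ℍ}
    (hu : (u.re - m) ^ 2 + u.im ^ 2 = ρ ^ 2) (hv : (v.re - m) ^ 2 + v.im ^ 2 = ρ ^ 2)
    (hw : (w.re - m) ^ 2 + w.im ^ 2 = ρ ^ 2) (huv : u.re ≤ v.re) (hvw : v.re ≤ w.re) :
    dist u v + dist v w = dist u w := by
  rw [dist_eq_of_mem_circle hρ hu hv, dist_eq_of_mem_circle hρ hv hw,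
    dist_eq_of_mem_circle hρ hu hw]
  have h1 : Real.artanh ((u.re - m) / ρ) ≤ Real.artanh ((v.re - m) / ρ) :=
    Real.strictMonoOn_artanh.monotoneOn (mem_Ioo_of_mem_circle hρ hu)
      (mem_Ioo_of_mem_circle hρ hv) (by gcongr)
  have h2 : Real.artanh ((v.re - m) / ρ) ≤ Real.artanh ((w.re - m) / ρ) :=
    Real.strictMonoOn_artanh.monotoneOn (mem_Ioo_of_mem_circle hρ hv)
      (mem_Ioo_of_mem_circle hρ hw) (by gcongr)
  rw [abs_of_nonpos (by linarith), abs_of_nonpos (by linarith), abs_of_nonpos (by linarith)]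
  ring

/-- The cosine profile of the broken geodesic through the points `e ^ (k ℓ) w`, where `|w| = 1`
and `Re w = x`. -/
def bendCos (x l t : ℝ) : ℝ := x * Real.cosh (l * (Int.fract (t / l) - 1 / 2)) / Real.cosh (l / 2)

/-- On a period the even function cosh is largest at the ends. The broken geodesic thus stays in a
sector around the imaginary axis, away from the real line except near its ends 0 and ∞. -/
theorem abs_bendCos_le (x : ℝ) {l : ℝ} (hl : 0 < l) (t : ℝ) : |bendCos x l t| ≤ |x| := by
  have h : Real.cosh (l * (Int.fract (t / l) - 1 / 2)) ≤ Real.cosh (l / 2) := by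
    rw [Real.cosh_le_cosh, abs_mul, abs_of_pos hl, abs_of_pos (half_pos hl)]
    have : |Int.fract (t / l) - 1 / 2| ≤ 1 / 2 := by
      rw [abs_le]
      constructor <;> linarith [Int.fract_nonneg (t / l), Int.fract_lt_one (t / l)]
    calc l * _ ≤ l * (1 / 2) := by gcongr
      _ = l / 2 := by ring
  rw [bendCos, abs_div, abs_mul, abs_of_pos (Real.cosh_pos _), abs_of_pos (Real.cosh_pos _),
    div_le_iff₀ (Real.cosh_pos _)]
  gcongr

theorem continuous_bendCos (x l : ℝ) : Continuous (bendCos x l) := by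
  have h : Continuous ((fun s : ℝ => x * Real.cosh (l * (s - 1 / 2)) / Real.cosh (l / 2)) ∘
      Int.fract) := by
    apply ContinuousOn.comp_fract''
    · apply Continuous.continuousOn
      fun_prop
    · have : l * ((0 : ℝ) - 1 / 2) = -(l * (1 - 1 / 2)) := by ring
      simp only [this, Real.cosh_neg]
  exact h.comp (continuous_id.div_const l)

theorem bendCos_add_zsmul (x : ℝ) {l : ℝ} (hl : 0 < l) (t : ℝ) (k : ℤ) :
    bendCos x l (t + k * l) = bendCos x l t := by
  have : (t + k * l) / l = t / l + k := by field_simp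
  rw [bendCos, bendCos, this, Int.fract_add_intCast]

theorem bendCos_of_mem_Ico (x : ℝ) {l t : ℝ} (ht : t ∈ Set.Ico 0 l) :
    bendCos x l t = x * Real.cosh (t - l / 2) / Real.cosh (l / 2) := by
  have hl : 0 < l := ht.1.trans_lt ht.2
  have : Int.fract (t / l) = t / l := by
    rw [Int.fract_eq_self]
    exact ⟨div_nonneg ht.1 hl.le, (div_lt_one hl).2 ht.2⟩
  rw [bendCos, this]
  congr 3
  field_simp

theorem bendCos_zero (x : ℝ) {l : ℝ} (hl : 0 < l) : bendCos x l 0 = x := by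
  rw [bendCos_of_mem_Ico x ⟨le_rfl, hl⟩, zero_sub, Real.cosh_neg]
  field_simp

theorem bendCos_sq_lt_one {x l : ℝ} (hx : |x| < 1) (hl : 0 < l) (t : ℝ) :
    bendCos x l t ^ 2 < 1 :=
  (sq_lt_one_iff_abs_lt_one _).2 ((abs_bendCos_le x hl t).trans_lt hx)

/-- The broken geodesic through the points `e ^ (k ℓ) w`, where `|w| = 1` and `Re w = x`,
parametrized by the logarithm of the absolute value. -/
def bend {x l : ℝ} (hx : |x| < 1) (hl : 0 < l) (t : ℝ) : ℍ :=
  ⟨⟨Real.exp t * bendCos x l t, Real.exp t * √(1 - bendCos x l t ^ 2)⟩,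
    mul_pos (Real.exp_pos t) (Real.sqrt_pos.2 (sub_pos.2 (bendCos_sq_lt_one hx hl t)))⟩

section bend

variable {x l : ℝ} (hx : |x| < 1) (hl : 0 < l)

theorem bend_re (t : ℝ) : (bend hx hl t).re = Real.exp t * bendCos x l t := rfl

theorem bend_im (t : ℝ) : (bend hx hl t).im = Real.exp t * √(1 - bendCos x l t ^ 2) := rfl

theorem bend_im_sq (t : ℝ) :
    (bend hx hl t).im ^ 2 = Real.exp t ^ 2 * (1 - bendCos x l t ^ 2) := by
  rw [bend_im, mul_pow, Real.sq_sqrt (sub_pos.2 (bendCos_sq_lt_one hx hl t)).le]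

theorem norm_eq_sqrt (z : ℍ) : ‖(z : ℂ)‖ = √(z.re ^ 2 + z.im ^ 2) := by
  rw [Complex.norm_def, Complex.normSq_apply, sq, sq]; rfl

theorem norm_bend (t : ℝ) : ‖(bend hx hl t : ℂ)‖ = Real.exp t := by
  rw [norm_eq_sqrt, bend_im_sq, bend_re]
  rw [show (Real.exp t * bendCos x l t) ^ 2 + Real.exp t ^ 2 * (1 - bendCos x l t ^ 2)
    = Real.exp t ^ 2 by ring]
  exact Real.sqrt_sq (Real.exp_pos t).le

theorem continuous_coe_bend : Continuous fun t => (bend hx hl t : ℂ) := by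
  have h : (fun t => (bend hx hl t : ℂ)) = fun t =>
      ((Real.exp t * bendCos x l t : ℝ) : ℂ) +
        ((Real.exp t * √(1 - bendCos x l t ^ 2) : ℝ) : ℂ) * Complex.I := by
    funext t
    rw [← UpperHalfPlane.re_add_im, bend_re, bend_im]
  have hc := continuous_bendCos x l
  rw [h]
  fun_prop

theorem bend_add_zsmul (t : ℝ) (k : ℤ) :
    (bend hx hl (t + k * l) : ℂ) = Real.exp (k * l) * (bend hx hl t : ℂ) := by
  apply Complex.ext
  · rw [Complex.re_ofReal_mul]
    simp only [UpperHalfPlane.coe_re, bend_re, bendCos_add_zsmul x hl, Real.exp_add]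
    ring
  · rw [Complex.im_ofReal_mul]
    simp only [UpperHalfPlane.coe_im, bend_im, bendCos_add_zsmul x hl, Real.exp_add]
    ring

/-- A point with the right argument lies on the broken geodesic. -/
theorem eq_bend_of_re_eq {w : ℍ}
    (h : w.re = ‖(w : ℂ)‖ * bendCos x l (Real.log ‖(w : ℂ)‖)) :
    w = bend hx hl (Real.log ‖(w : ℂ)‖) := by
  have hpos : 0 < ‖(w : ℂ)‖ := norm_pos_iff.2 w.ne_zero
  apply UpperHalfPlane.eq_of_re_of_norm
  · rw [bend_re, Real.exp_log hpos, ← h]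
  · rw [norm_bend, Real.exp_log hpos]

/-- A circle centred at a real m through w and e^l w, with |w| = 1, has equation |z|² - 2m Re z +
e^l = 0, so on it Re z is affine in |z|². -/
theorem bend_re_of_mem_Ico {t : ℝ} (ht : t ∈ Set.Ico 0 l) :
    (bend hx hl t).re = x * ((Real.exp t) ^ 2 + Real.exp l) / (Real.exp l + 1) := by
  rw [bend_re, bendCos_of_mem_Ico x ht, Real.cosh_eq, Real.cosh_eq]
  have h1 : Real.exp (t - l / 2) = Real.exp t / Real.exp (l / 2) := Real.exp_sub _ _
  have h2 : Real.exp (-(t - l / 2)) = Real.exp (l / 2) / Real.exp t := by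
    rw [← Real.exp_sub]; congr 1; ring
  have h3 : Real.exp (-(l / 2)) = 1 / Real.exp (l / 2) := by rw [Real.exp_neg]; field_simp
  have h4 : Real.exp l = Real.exp (l / 2) ^ 2 := by rw [← Real.exp_nat_mul]; congr 1; push_cast; ring
  rw [h1, h2, h3, h4]
  have := Real.exp_pos t
  have := Real.exp_pos (l / 2)
  field_simp

theorem bend_normSq (t : ℝ) : (bend hx hl t).re ^ 2 + (bend hx hl t).im ^ 2 = Real.exp t ^ 2 := by
  rw [bend_im_sq, bend_re]; ring

/-- Each piece of the curve is a true geodesic segment, so distances add up along it. -/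
theorem dist_bend_add_dist_bend {t : ℝ} (ht : t ∈ Set.Ico 0 l) :
    dist (bend hx hl 0) (bend hx hl t) + dist (bend hx hl t) (bend hx hl l) =
      dist (bend hx hl 0) (bend hx hl l) := by
  have hL : 1 < Real.exp l := Real.one_lt_exp_iff.2 hl
  have h1t : 1 ≤ Real.exp t := Real.one_le_exp ht.1
  have htl : Real.exp t ≤ Real.exp l := Real.exp_le_exp.2 ht.2.le
  have hr0 : (bend hx hl 0).re = x := by rw [bend_re, bendCos_zero x hl]; simp
  have hrl : (bend hx hl l).re = Real.exp l * x := by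
    have := bendCos_add_zsmul x hl 0 1
    rw [bend_re]
    simp only [Int.cast_one, one_mul, zero_add] at this
    rw [this, bendCos_zero x hl]
  have hrt := bend_re_of_mem_Ico hx hl ht
  have n0 := bend_normSq hx hl 0
  have nl := bend_normSq hx hl l
  have nt := bend_normSq hx hl t
  rw [Real.exp_zero] at n0
  rcases eq_or_ne x 0 with h0 | h0
  -- For x = 0 the circle degenerates to the imaginary axis.
  · have e0 : (bend hx hl 0).re = 0 := by rw [hr0, h0]
    have el : (bend hx hl l).re = 0 := by rw [hrl, h0, mul_zero]
    have et : (bend hx hl t).re = 0 := by rw [hrt, h0]; simp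
    have him : ∀ s, (bend hx hl s).re = 0 → Real.log (bend hx hl s).im = s := by
      intro s hs
      have := norm_bend hx hl s
      rw [norm_eq_sqrt, hs, zero_pow two_ne_zero, zero_add,
        Real.sqrt_sq (bend hx hl s).im_pos.le] at this
      rw [this, Real.log_exp]
    rw [UpperHalfPlane.dist_of_re_eq (e0.trans et.symm), UpperHalfPlane.dist_of_re_eq
      (et.trans el.symm), UpperHalfPlane.dist_of_re_eq (e0.trans el.symm), him _ e0, him _ et,
      him _ el, Real.dist_eq, Real.dist_eq, Real.dist_eq, abs_of_nonpos (by linarith [ht.1]),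
      abs_of_nonpos (by linarith [ht.2]), abs_of_nonpos (by linarith)]
    ring
  · set L := Real.exp l
    -- The centre of the circle through w and L w; its squared radius m² - L is positive because |x|
    -- < 1 < L.
    set m := (L + 1) / (2 * x) with hm
    have hmx : 2 * m * x = L + 1 := by rw [hm]; field_simp
    have hxx : x ^ 2 < 1 := (sq_lt_one_iff_abs_lt_one _).2 hx
    have hmm : 0 < m ^ 2 - L := by
      have h4 : (L + 1) ^ 2 = 4 * m ^ 2 * x ^ 2 := by rw [← hmx]; ring
      have h5 : 0 < (L - 1) ^ 2 := pow_pos (sub_pos.2 hL) 2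
      have h6 : m ^ 2 * x ^ 2 ≤ m ^ 2 := mul_le_of_le_one_right (sq_nonneg m) hxx.le
      linarith
    have hρ : 0 < √(m ^ 2 - L) := Real.sqrt_pos.2 hmm
    have hρ2 : √(m ^ 2 - L) ^ 2 = m ^ 2 - L := Real.sq_sqrt hmm.le
    have c0 : ((bend hx hl 0).re - m) ^ 2 + (bend hx hl 0).im ^ 2 = √(m ^ 2 - L) ^ 2 := by
      rw [hρ2]; rw [hr0] at n0 ⊢; linarith
    have cl : ((bend hx hl l).re - m) ^ 2 + (bend hx hl l).im ^ 2 = √(m ^ 2 - L) ^ 2 := by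
      rw [hρ2]; rw [hrl] at nl ⊢; linear_combination nl - L * hmx
    have ct : ((bend hx hl t).re - m) ^ 2 + (bend hx hl t).im ^ 2 = √(m ^ 2 - L) ^ 2 := by
      have : 2 * m * (bend hx hl t).re = Real.exp t ^ 2 + L := by
        rw [hrt, mul_div_assoc', div_eq_iff (by positivity)]
        linear_combination (Real.exp t ^ 2 + L) * hmx
      rw [hρ2]; linear_combination nt - this
    have b1 : L + 1 ≤ Real.exp t ^ 2 + L := by linarith [one_le_pow₀ h1t (n := 2)]
    have b2 : Real.exp t ^ 2 + L ≤ L * (L + 1) := by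
      linarith [pow_le_pow_left₀ (by positivity) htl 2]
    rcases h0.lt_or_gt with h | h
    · have i1 : (bend hx hl t).re ≤ (bend hx hl 0).re := by
        rw [hrt, hr0, div_le_iff₀ (by positivity)]; exact mul_le_mul_of_nonpos_left b1 h.le
      have i2 : (bend hx hl l).re ≤ (bend hx hl t).re := by
        rw [hrt, hrl, le_div_iff₀ (by positivity)]
        linarith [mul_le_mul_of_nonpos_left b2 h.le]
      have := dist_add_dist_of_mem_circle hρ cl ct c0 i2 i1
      rw [dist_comm (bend hx hl 0), dist_comm _ (bend hx hl l), dist_comm _ (bend hx hl l), add_comm]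
      exact this
    · have i1 : (bend hx hl 0).re ≤ (bend hx hl t).re := by
        rw [hrt, hr0, le_div_iff₀ (by positivity)]; exact mul_le_mul_of_nonneg_left b1 h.le
      have i2 : (bend hx hl t).re ≤ (bend hx hl l).re := by
        rw [hrt, hrl, div_le_iff₀ (by positivity)]
        linarith [mul_le_mul_of_nonneg_left b2 h.le]
      exact dist_add_dist_of_mem_circle hρ c0 ct cl i1 i2

end bend

end HyperbolicSurface

/-! ### Crossings of the broken geodesic with its images -/

namespace HyperbolicSurface

theorem sl_denom_ne_zero (g : SL(2, ℝ)) (z : ℍ) : (g 1 0 : ℂ) * z + g 1 1 ≠ 0 :=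
  UpperHalfPlane.denom_ne_zero (g : GL (Fin 2) ℝ) z

theorem coe_sl_smul (g : SL(2, ℝ)) (z : ℍ) :
    ((g • z : ℍ) : ℂ) = (g 0 0 * z + g 0 1) / (g 1 0 * z + g 1 1) :=
  UpperHalfPlane.coe_specialLinearGroup_apply g z

theorem sl_det_eq (g : SL(2, ℝ)) : g 0 0 * g 1 1 - g 0 1 * g 1 0 = 1 := by
  rw [← Matrix.det_fin_two]; exact g.det_coe

theorem tendsto_re_div_norm {α : Type*} {F : Filter α} {u : α → ℂ} {r : ℝ} (hr : r ≠ 0)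
    (hu : Tendsto u F (𝓝 (r : ℂ))) : Tendsto (fun t => (u t).re / ‖u t‖) F (𝓝 (r / |r|)) := by
  have h1 : Tendsto (fun t => (u t).re) F (𝓝 r) :=
    (Complex.continuous_re.tendsto _).comp hu
  have h2 : Tendsto (fun t => ‖u t‖) F (𝓝 |r|) := by
    simpa using hu.norm
  exact h1.div h2 (abs_ne_zero.2 hr)

section crossing

variable {x l : ℝ} (hx : |x| < 1) (hl : 0 < l)

/-- The broken geodesic runs to ∞ as the axis does, so its image ends at g(∞) = a/c; likewise at the
other end it tends to g(0) = b/d. -/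
theorem tendsto_smul_bend_atTop (g : SL(2, ℝ)) (hc : g 1 0 ≠ 0) :
    Tendsto (fun t => ((g • bend hx hl t : ℍ) : ℂ)) atTop (𝓝 ((g 0 0 / g 1 0 : ℝ) : ℂ)) := by
  have hinv : Tendsto (fun t => (bend hx hl t : ℂ)⁻¹) atTop (𝓝 0) := by
    rw [tendsto_zero_iff_norm_tendsto_zero]
    simp only [norm_inv, norm_bend]
    exact Real.tendsto_exp_atTop.inv_tendsto_atTop
  have h : (fun t => ((g • bend hx hl t : ℍ) : ℂ)) = fun t =>
      (g 0 0 + g 0 1 * (bend hx hl t : ℂ)⁻¹) / (g 1 0 + g 1 1 * (bend hx hl t : ℂ)⁻¹) := by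
    funext t
    have h0 := (bend hx hl t).ne_zero
    rw [coe_sl_smul, ← mul_div_mul_right _ _ (inv_ne_zero h0), add_mul, add_mul,
      mul_inv_cancel_right₀ h0, mul_inv_cancel_right₀ h0]
  rw [h]
  have := ((hinv.const_mul (g 0 1 : ℂ)).const_add (g 0 0 : ℂ)).div
    ((hinv.const_mul (g 1 1 : ℂ)).const_add (g 1 0 : ℂ)) (by simpa using hc)
  simpa [Pi.div_def] using this

theorem tendsto_smul_bend_atBot (g : SL(2, ℝ)) (hd : g 1 1 ≠ 0) :
    Tendsto (fun t => ((g • bend hx hl t : ℍ) : ℂ)) atBot (𝓝 ((g 0 1 / g 1 1 : ℝ) : ℂ)) := by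
  have h0 : Tendsto (fun t => (bend hx hl t : ℂ)) atBot (𝓝 0) := by
    rw [tendsto_zero_iff_norm_tendsto_zero]
    simp only [norm_bend]
    exact Real.tendsto_exp_atBot
  simp only [coe_sl_smul]
  have := ((h0.const_mul (g 0 0 : ℂ)).add_const (g 0 1 : ℂ)).div
    ((h0.const_mul (g 1 0 : ℂ)).add_const (g 1 1 : ℂ)) (by simpa using hd)
  simpa [Pi.div_def] using this

/-- If `g` maps the end points of the imaginary axis to real numbers of opposite signs, then the
broken geodesic meets its image under `g`. -/
theorem exists_smul_bend_eq_bend (g : SL(2, ℝ)) (hc : g 1 0 ≠ 0) (hd : g 1 1 ≠ 0)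
    (hsign : g 0 0 / g 1 0 * (g 0 1 / g 1 1) < 0) :
    ∃ s t, g • bend hx hl s = bend hx hl t := by
  set u : ℝ → ℂ := fun t => ((g • bend hx hl t : ℍ) : ℂ) with hu
  have hu0 : ∀ t, ‖u t‖ ≠ 0 := fun t => norm_ne_zero_iff.2 (UpperHalfPlane.ne_zero _)
  have hcu : Continuous u := by
    simp only [hu, coe_sl_smul]
    have hb := continuous_coe_bend hx hl
    exact Continuous.div (by fun_prop) (by fun_prop) fun t => sl_denom_ne_zero g _
  -- F compares the cosine of the argument of u with that of the broken geodesic at the same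
  -- absolute value; it has opposite signs near the two ends, and a zero is a crossing.
  set F : ℝ → ℝ := fun t => (u t).re / ‖u t‖ - bendCos x l (Real.log ‖u t‖) with hF
  have hcF : Continuous F := by
    have hcos := continuous_bendCos x l
    have hlog : Continuous fun t => Real.log ‖u t‖ := hcu.norm.log hu0
    exact ((Complex.continuous_re.comp hcu).div hcu.norm hu0).sub (hcos.comp hlog)
  have hpos : ∀ (f : Filter ℝ) (r : ℝ), Tendsto u f (𝓝 (r : ℂ)) → 0 < r → ∀ᶠ t in f, 0 ≤ F t := by
    intro f r hf hr
    have h := tendsto_re_div_norm hr.ne' hf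
    rw [abs_of_pos hr, div_self hr.ne'] at h
    filter_upwards [h.eventually (lt_mem_nhds hx)] with t ht
    have := (abs_le.1 (abs_bendCos_le x hl (Real.log ‖u t‖))).2
    simp only [hF]; linarith
  have hneg : ∀ (f : Filter ℝ) (r : ℝ), Tendsto u f (𝓝 (r : ℂ)) → r < 0 → ∀ᶠ t in f, F t ≤ 0 := by
    intro f r hf hr
    have h := tendsto_re_div_norm hr.ne hf
    rw [abs_of_neg hr, div_neg, div_self hr.ne] at h
    filter_upwards [h.eventually (gt_mem_nhds (neg_lt_neg hx))] with t ht
    have := (abs_le.1 (abs_bendCos_le x hl (Real.log ‖u t‖))).1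
    simp only [hF]; linarith
  have htop := tendsto_smul_bend_atTop hx hl g hc
  have hbot := tendsto_smul_bend_atBot hx hl g hd
  obtain ⟨s, hs⟩ : (0 : ℝ) ∈ Set.range F := by
    rcases mul_neg_iff.1 hsign with ⟨h1, h2⟩ | ⟨h1, h2⟩
    · exact mem_range_of_exists_le_of_exists_ge hcF (hneg _ _ hbot h2).exists
        (hpos _ _ htop h1).exists
    · exact mem_range_of_exists_le_of_exists_ge hcF (hneg _ _ htop h1).exists
        (hpos _ _ hbot h2).exists
  refine ⟨s, Real.log ‖u s‖, eq_bend_of_re_eq hx hl ?_⟩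
  have h : (u s).re / ‖u s‖ = bendCos x l (Real.log ‖u s‖) := sub_eq_zero.1 hs
  change (u s).re = ‖u s‖ * _
  rw [← h, mul_div_cancel₀ _ (hu0 s)]

end crossing

/-- The point `i e ^ t`. -/
def iexp (t : ℝ) : ℍ := ⟨⟨0, Real.exp t⟩, Real.exp_pos t⟩

theorem isometry_iexp : Isometry iexp := UpperHalfPlane.isometry_vertical_line 0

theorem coe_iexp (t : ℝ) : (iexp t : ℂ) = Real.exp t * Complex.I := by
  apply Complex.ext <;> simp [iexp, Complex.exp_ofReal_re]

/-- An element of `SL(2, ℝ)` that maps a point of the imaginary axis into the axis. -/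
theorem entries_of_smul_iexp {g : SL(2, ℝ)} {s t : ℝ} (h : g • iexp s = iexp t) :
    g 0 1 = -(Real.exp s * Real.exp t) * g 1 0 ∧ g 0 0 * Real.exp s = Real.exp t * g 1 1 := by
  have h1 := congrArg UpperHalfPlane.coe h
  rw [coe_sl_smul, div_eq_iff (sl_denom_ne_zero g _), coe_iexp, coe_iexp] at h1
  have hre := congrArg Complex.re h1
  have him := congrArg Complex.im h1
  simp [Complex.exp_ofReal_re, Complex.exp_ofReal_im] at hre him
  constructor <;> linarith

theorem coe_zpow_smul {D : SL(2, ℝ)} {l : ℝ}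
    (hD : ∀ w : ℍ, ((D • w : ℍ) : ℂ) = Real.exp l * w) (k : ℤ) (w : ℍ) :
    ((D ^ k • w : ℍ) : ℂ) = Real.exp (k * l) * w := by
  have hDi : ∀ w : ℍ, ((D⁻¹ • w : ℍ) : ℂ) = Real.exp (-l) * w := by
    intro w
    have := hD (D⁻¹ • w)
    rw [smul_inv_smul] at this
    rw [this, ← mul_assoc, ← Complex.ofReal_mul, ← Real.exp_add]
    simp
  induction k using Int.induction_on generalizing w with
  | zero => simp
  | succ n ih =>
    rw [zpow_add_one, mul_smul, ih, hD, ← mul_assoc, ← Complex.ofReal_mul, ← Real.exp_add]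
    congr 3; push_cast; ring
  | pred n ih =>
    rw [zpow_sub_one, mul_smul, ih, hDi, ← mul_assoc, ← Complex.ofReal_mul, ← Real.exp_add]
    congr 3; push_cast; ring

theorem zpow_smul_bend {x l : ℝ} (hx : |x| < 1) (hl : 0 < l) {D : SL(2, ℝ)}
    (hD : ∀ w : ℍ, ((D • w : ℍ) : ℂ) = Real.exp l * w) (k : ℤ) (t : ℝ) :
    D ^ k • bend hx hl t = bend hx hl (t + k * l) := by
  apply UpperHalfPlane.ext
  rw [coe_zpow_smul hD, bend_add_zsmul]

theorem exists_add_zsmul_mem_Ico {l : ℝ} (hl : 0 < l) (t : ℝ) :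
    ∃ k : ℤ, t + k * l ∈ Set.Ico 0 l := by
  refine ⟨-⌊t / l⌋, ?_⟩
  have h1 := (le_div_iff₀ hl).1 (Int.floor_le (t / l))
  have h2 := (div_lt_iff₀ hl).1 (Int.lt_floor_add_one (t / l))
  push_cast
  constructor <;> linarith

/-- A point equidistant from `w` and `λ w` has absolute value `√λ |w|`. -/
theorem norm_sq_of_dist_eq_dist {D : SL(2, ℝ)} {l : ℝ} (hl : 0 < l)
    (hD : ∀ w : ℍ, ((D • w : ℍ) : ℂ) = Real.exp l * w) {w m : ℍ}
    (h : dist w m = dist m (D • w)) :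
    m.re ^ 2 + m.im ^ 2 = Real.exp l * (w.re ^ 2 + w.im ^ 2) := by
  have hre : (D • w).re = Real.exp l * w.re := by
    have := congrArg Complex.re (hD w)
    rwa [Complex.re_ofReal_mul] at this
  have him : (D • w).im = Real.exp l * w.im := by
    have := congrArg Complex.im (hD w)
    rwa [Complex.im_ofReal_mul] at this
  have h1 := congrArg Real.cosh h
  rw [UpperHalfPlane.cosh_dist', UpperHalfPlane.cosh_dist', hre, him] at h1
  have hw := w.im_pos
  have hm := m.im_pos
  have hL : 1 < Real.exp l := Real.one_lt_exp_iff.2 hl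
  rw [div_eq_div_iff (by positivity) (by positivity)] at h1
  have h2 : 2 * w.im * m.im * (Real.exp l - 1) *
      (m.re ^ 2 + m.im ^ 2 - Real.exp l * (w.re ^ 2 + w.im ^ 2)) = 0 := by
    linear_combination h1
  have h3 : 2 * w.im * m.im * (Real.exp l - 1) ≠ 0 :=
    mul_ne_zero (by positivity) (sub_pos.2 hL).ne'
  linarith [(mul_eq_zero.1 h2).resolve_left h3]

/-- If the displacement of `D : w ↦ e ^ l w` at `w₀` is minimal among the nontrivial elements of a
group acting freely, an element of the group whose image of the imaginary axis meets the axis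
preserves the axis. The broken geodesic through the points `D ^ k w₀` would otherwise meet its image
at an interior angle, and cutting and pasting there would give a smaller displacement. -/
theorem diagonal_or_antidiagonal {G : Subgroup SL(2, ℝ)}
    (hfree : ∀ g ∈ G, ∀ w : ℍ, g • w = w → ∀ w' : ℍ, g • w' = w')
    {D : SL(2, ℝ)} {l : ℝ} (hl : 0 < l)
    (hD : ∀ w : ℍ, ((D • w : ℍ) : ℂ) = Real.exp l * w) (hDG : D ∈ G)
    {w₀ : ℍ} (hw₀ : ‖(w₀ : ℂ)‖ = 1)
    (hmin : ∀ g ∈ G, g • w₀ ≠ w₀ → dist w₀ (D • w₀) ≤ dist w₀ (g • w₀))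
    {g : SL(2, ℝ)} (hg : g ∈ G) {s t : ℝ} (hst : g • iexp s = iexp t) :
    g 1 0 = 0 ∨ g 1 1 = 0 := by
  by_contra! hcon
  obtain ⟨hc, hd⟩ := hcon
  obtain ⟨hb, ha⟩ := entries_of_smul_iexp hst
  -- A geodesic through i e^t other than the axis has its ends on both sides of 0; their product is
  -- -e^(2t).
  have hsign : g 0 0 / g 1 0 * (g 0 1 / g 1 1) < 0 := by
    have e : g 0 0 = Real.exp t / Real.exp s * g 1 1 := by
      field_simp; linarith
    have : g 0 0 / g 1 0 * (g 0 1 / g 1 1) = -(Real.exp t * Real.exp t) := by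
      rw [hb, e]; field_simp
    rw [this]
    have := Real.exp_pos t
    nlinarith
  have hx : |w₀.re| < 1 := by
    have h := norm_eq_sqrt w₀
    rw [hw₀, eq_comm, Real.sqrt_eq_one] at h
    rw [← sq_lt_one_iff_abs_lt_one]
    have := pow_pos w₀.im_pos 2
    linarith
  have hP0 : bend hx hl 0 = w₀ := by
    apply UpperHalfPlane.eq_of_re_of_norm
    · rw [bend_re, bendCos_zero _ hl]; simp
    · rw [norm_bend, hw₀, Real.exp_zero]
  have hPl : bend hx hl l = D • w₀ := by
    have := zpow_smul_bend hx hl hD 1 0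
    rw [zpow_one, hP0] at this
    rw [this]; congr 1; simp
  obtain ⟨t₁, t₂, h12⟩ := exists_smul_bend_eq_bend hx hl g hc hd hsign
  obtain ⟨k₁, hk₁⟩ := exists_add_zsmul_mem_Ico hl t₁
  obtain ⟨k₂, hk₂⟩ := exists_add_zsmul_mem_Ico hl t₂
  -- Powers of D bring both crossing points into the one segment from w₀ to D w₀.
  set f : SL(2, ℝ) := D ^ k₂ * g * (D ^ k₁)⁻¹ with hf
  have hfP : f • bend hx hl (t₁ + k₁ * l) = bend hx hl (t₂ + k₂ * l) := by
    rw [hf, mul_smul, mul_smul, ← zpow_smul_bend hx hl hD, ← zpow_smul_bend hx hl hD,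
      inv_smul_smul, h12]
  have hfG : f ∈ G := G.mul_mem (G.mul_mem (G.zpow_mem hDG _) hg) (G.inv_mem (G.zpow_mem hDG _))
  -- If such an element acted trivially, g would act as a power of D and keep every i e^r on the
  -- axis; the relation between its entries b and c, valid for two values of r, then forces c = 0.
  have hnt : ∀ m n : ℤ, D ^ m * f * D ^ n ∈ G ∧ ∀ w : ℍ, (D ^ m * f * D ^ n) • w ≠ w := by
    intro m n
    have hmem : D ^ m * f * D ^ n ∈ G :=
      G.mul_mem (G.mul_mem (G.zpow_mem hDG _) hfG) (G.zpow_mem hDG _)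
    refine ⟨hmem, fun w hw => ?_⟩
    have htriv := hfree _ hmem w hw
    have hgact : ∀ w : ℍ, g • w = D ^ (k₁ - k₂ - m - n) • w := by
      intro w
      have h1 := htriv (D ^ (k₁ - n) • w)
      have h2 : D ^ m * f * D ^ n * D ^ (k₁ - n) = D ^ (m + k₂) * g := by
        rw [hf, zpow_add, zpow_sub, ← zpow_neg]
        simp only [mul_assoc]
        congr 3
        rw [← zpow_neg, ← zpow_add, ← zpow_add, ← zpow_add]
        simp
      rw [smul_smul, h2, mul_smul] at h1
      rw [← inv_smul_smul (D ^ (m + k₂)) (g • w), h1, smul_smul, ← zpow_neg, ← zpow_add]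
      congr 2; ring
    set μ : ℝ := Real.exp ((k₁ - k₂ - m - n : ℤ) * l) with hμ
    have hμ0 : 0 < μ := Real.exp_pos _
    have hq : ∀ r : ℝ, g 0 1 = -(μ * Real.exp r ^ 2) * g 1 0 := by
      intro r
      have h3 : g • iexp r = iexp ((k₁ - k₂ - m - n : ℤ) * l + r) := by
        rw [hgact]
        apply UpperHalfPlane.ext
        rw [coe_zpow_smul hD, coe_iexp, coe_iexp, Real.exp_add]
        push_cast; ring
      rw [(entries_of_smul_iexp h3).1, Real.exp_add]
      ring
    have h0 := hq 0
    have h1 := hq 1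
    have he : 1 < Real.exp 1 := Real.one_lt_exp_iff.2 one_pos
    rw [Real.exp_zero] at h0
    have h4 : μ * (Real.exp 1 ^ 2 - 1) * g 1 0 = 0 := by linear_combination h1 - h0
    rcases mul_eq_zero.1 h4 with h5 | h5
    · rcases mul_eq_zero.1 h5 with h6 | h6
      · exact hμ0.ne' h6
      · nlinarith
    · exact hc h5
  set τ₁ := t₁ + k₁ * l
  set τ₂ := t₂ + k₂ * l
  have hD0 : ∀ m n : ℤ, dist w₀ (D • w₀) ≤ dist w₀ ((D ^ m * f * D ^ n) • w₀) := fun m n =>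
    hmin _ (hnt m n).1 ((hnt m n).2 _)
  have a1 := dist_bend_add_dist_bend hx hl hk₁
  have a2 := dist_bend_add_dist_bend hx hl hk₂
  rw [hP0, hPl] at a1 a2
  set p₁ := bend hx hl τ₁ with hp₁
  set p₂ := bend hx hl τ₂ with hp₂
  -- Cut and paste: go from an end of the segment to p₂ = f p₁, then along the f-image of the
  -- segment to an end of it. The four choices of ends correspond to f, f D, D⁻¹ f and D⁻¹ f D.
  have i1 : dist w₀ (f • w₀) ≤ dist w₀ p₂ + dist w₀ p₁ := by
    calc _ ≤ dist w₀ p₂ + dist p₂ (f • w₀) := dist_triangle _ _ _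
      _ = _ := by rw [← hfP, dist_smul, dist_comm p₁]
  have i2 : dist w₀ ((f * D) • w₀) ≤ dist w₀ p₂ + dist p₁ (D • w₀) := by
    calc _ ≤ dist w₀ p₂ + dist p₂ ((f * D) • w₀) := dist_triangle _ _ _
      _ = _ := by rw [mul_smul, ← hfP, dist_smul]
  have i3 : dist w₀ ((D⁻¹ * f) • w₀) ≤ dist p₂ (D • w₀) + dist w₀ p₁ := by
    calc _ = dist (D • w₀) (f • w₀) := by
          rw [← dist_smul D w₀, mul_smul, smul_inv_smul]
      _ ≤ dist (D • w₀) p₂ + dist p₂ (f • w₀) := dist_triangle _ _ _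
      _ = _ := by rw [dist_comm _ p₂]; conv_lhs => rw [← hfP, dist_smul, dist_comm p₁ w₀, hfP]
  have i4 : dist w₀ ((D⁻¹ * f * D) • w₀) ≤ dist p₂ (D • w₀) + dist p₁ (D • w₀) := by
    calc _ = dist (D • w₀) ((f * D) • w₀) := by
          rw [← dist_smul D w₀, mul_assoc, mul_smul D⁻¹, smul_inv_smul]
      _ ≤ dist (D • w₀) p₂ + dist p₂ ((f * D) • w₀) := dist_triangle _ _ _
      _ = _ := by rw [dist_comm _ p₂]; conv_lhs => rw [mul_smul, ← hfP, dist_smul, hfP]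
  have j1 := hD0 0 0
  have j2 := hD0 0 1
  have j3 := hD0 (-1) 0
  have j4 := hD0 (-1) 1
  simp only [zpow_zero, zpow_one, zpow_neg, one_mul, mul_one] at j1 j2 j3 j4
  -- All four sums are at least the segment length d, while complementary sums add up to 2d. So all
  -- equal d, and p₁, p₂ are both equidistant from w₀ and D w₀.
  have n1 := norm_sq_of_dist_eq_dist hl hD (w := w₀) (m := p₁) (by linarith)
  have n2 := norm_sq_of_dist_eq_dist hl hD (w := w₀) (m := p₂) (by linarith)
  have heq : τ₁ = τ₂ := by
    have hn : ‖(p₁ : ℂ)‖ = ‖(p₂ : ℂ)‖ := by rw [norm_eq_sqrt, norm_eq_sqrt, n1, n2]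
    rw [hp₁, hp₂, norm_bend, norm_bend] at hn
    exact Real.exp_injective hn
  have hfix : f • p₁ = p₁ := by rw [hfP, hp₁, hp₂, heq]
  have := (hnt 0 0).2 p₁
  simp only [zpow_zero, one_mul, mul_one] at this
  exact this hfix

end HyperbolicSurface

/-! ### Simplicity of the axis, and normal forms of isometries -/

namespace HyperbolicSurface

/-- The displacement of `w ↦ e ^ u w`. -/
theorem cosh_dist_of_coe_eq_exp_mul {w w' : ℍ} {u : ℝ} (h : (w' : ℂ) = Real.exp u * w) :
    Real.cosh (dist w w') = 1 + (Real.cosh u - 1) * ((w.re ^ 2 + w.im ^ 2) / w.im ^ 2) := by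
  have hre : w'.re = Real.exp u * w.re := by
    have := congrArg Complex.re h
    rwa [Complex.re_ofReal_mul] at this
  have him : w'.im = Real.exp u * w.im := by
    have := congrArg Complex.im h
    rwa [Complex.im_ofReal_mul] at this
  rw [UpperHalfPlane.cosh_dist', hre, him, Real.cosh_eq, Real.exp_neg]
  have := Real.exp_pos u
  have := w.im_pos
  field_simp
  ring

/-- If the displacement of `D : w ↦ e ^ l w` at `w₀` is minimal among the nontrivial elements of a
group acting freely, no two points of `i [1, e ^ l)` are equivalent. -/
theorem eq_of_smul_iexp_eq {G : Subgroup SL(2, ℝ)}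
    (hfree : ∀ g ∈ G, ∀ w : ℍ, g • w = w → ∀ w' : ℍ, g • w' = w')
    {D : SL(2, ℝ)} {l : ℝ} (hl : 0 < l)
    (hD : ∀ w : ℍ, ((D • w : ℍ) : ℂ) = Real.exp l * w) (hDG : D ∈ G)
    {w₀ : ℍ} (hw₀ : ‖(w₀ : ℂ)‖ = 1)
    (hmin : ∀ g ∈ G, g • w₀ ≠ w₀ → dist w₀ (D • w₀) ≤ dist w₀ (g • w₀))
    {g : SL(2, ℝ)} (hg : g ∈ G) {s t : ℝ} (hs : s ∈ Set.Ico 0 l) (ht : t ∈ Set.Ico 0 l)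
    (hst : g • iexp s = iexp t) : s = t := by
  obtain ⟨hb, ha⟩ := entries_of_smul_iexp hst
  have hdet := sl_det_eq g
  rcases diagonal_or_antidiagonal hfree hl hD hDG hw₀ hmin hg hst with hc | hd
  -- Diagonal case: g is the dilation by e^(t-s) with |t - s| < l, so it would move w₀ less than D
  -- does.
  · by_contra hne
    have hb0 : g 0 1 = 0 := by rw [hb, hc, mul_zero]
    rw [hb0, zero_mul, sub_zero] at hdet
    have hd0 : g 1 1 ≠ 0 := right_ne_zero_of_mul_eq_one hdet
    have hq : g 0 0 = Real.exp (t - s) * g 1 1 := by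
      rw [Real.exp_sub]; field_simp; linarith
    have hact : ((g • w₀ : ℍ) : ℂ) = Real.exp (t - s) * w₀ := by
      have hd0' : ((g 1 1 : ℝ) : ℂ) ≠ 0 := Complex.ofReal_ne_zero.2 hd0
      rw [coe_sl_smul, hb0, hc, hq]
      rw [Complex.ofReal_zero, zero_mul, zero_add, add_zero, div_eq_iff hd0']
      push_cast
      ring
    have hlt : Real.cosh (t - s) < Real.cosh l := by
      rw [Real.cosh_lt_cosh, abs_of_pos hl, abs_lt]
      constructor <;> linarith [hs.1, hs.2, ht.1, ht.2]
    have hmove : g • w₀ ≠ w₀ := by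
      intro h
      have := hfree g hg w₀ h (iexp s)
      rw [hst] at this
      exact hne (isometry_iexp.injective this).symm
    have h1 := hmin g hg hmove
    have h2 : Real.cosh (dist w₀ (D • w₀)) ≤ Real.cosh (dist w₀ (g • w₀)) := by
      rw [Real.cosh_le_cosh, abs_of_nonneg dist_nonneg, abs_of_nonneg dist_nonneg]
      exact h1
    rw [cosh_dist_of_coe_eq_exp_mul (hD w₀), cosh_dist_of_coe_eq_exp_mul hact] at h2
    have hy := w₀.im_pos
    have hq0 : 0 < (w₀.re ^ 2 + w₀.im ^ 2) / w₀.im ^ 2 := by positivity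
    have := mul_lt_mul_of_pos_right (sub_lt_sub_right hlt 1) hq0
    linarith
  -- Antidiagonal case: g is a half-turn exchanging i e^s and i e^t, hence fixing their midpoint.
  · have ha0 : g 0 0 = 0 := by
      have := Real.exp_pos s
      rw [hd, mul_zero] at ha
      exact (mul_eq_zero.1 ha).resolve_right this.ne'
    have hc0 : g 1 0 ≠ 0 := by
      rintro h
      rw [h, ha0] at hdet
      simp at hdet
    have hfix : g • iexp ((s + t) / 2) = iexp ((s + t) / 2) := by
      apply UpperHalfPlane.ext
      have hc0' : ((g 1 0 : ℝ) : ℂ) ≠ 0 := Complex.ofReal_ne_zero.2 hc0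
      have hE : Real.exp s * Real.exp t = Real.exp ((s + t) / 2) ^ 2 := by
        rw [← Real.exp_add, ← Real.exp_nat_mul]; congr 1; push_cast; ring
      rw [coe_sl_smul, div_eq_iff (sl_denom_ne_zero g _), ha0, hd, hb, hE, coe_iexp]
      push_cast
      linear_combination (-(Complex.exp ((s + t) / 2) ^ 2 * (g 1 0 : ℂ))) * Complex.I_sq
    have := hfree g hg _ hfix (iexp s)
    rw [hst] at this
    exact (isometry_iexp.injective this).symm

/-- The displacement of an element of `SL(2, ℝ)`. -/
theorem cosh_dist_smul (g : SL(2, ℝ)) (z : ℍ) :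
    Real.cosh (dist z (g • z)) =
      1 + ‖(g 1 0 : ℂ) * z ^ 2 + (g 1 1 - g 0 0) * z - g 0 1‖ ^ 2 / (2 * z.im ^ 2) := by
  have hden := sl_denom_ne_zero g z
  have him : (g • z).im = z.im / ‖(g 1 0 : ℂ) * z + g 1 1‖ ^ 2 := by
    have := UpperHalfPlane.im_smul_eq_div_normSq (g : GL (Fin 2) ℝ) z
    simp [Complex.normSq_eq_norm_sq] at this
    exact this
  have hsub : (z : ℂ) - (g • z : ℍ) =
      ((g 1 0 : ℂ) * z ^ 2 + (g 1 1 - g 0 0) * z - g 0 1) / ((g 1 0 : ℂ) * z + g 1 1) := by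
    rw [coe_sl_smul, eq_div_iff hden, sub_mul, div_mul_cancel₀ _ hden]; ring
  rw [UpperHalfPlane.cosh_dist, Complex.dist_eq, hsub, him, norm_div, div_pow]
  have := z.im_pos
  have := norm_ne_zero_iff.2 hden
  field_simp

/-- Elliptic and parabolic elements have arbitrarily small displacement. -/
theorem exists_dist_smul_lt {g : SL(2, ℝ)} (htr : (g 0 0 + g 1 1) ^ 2 ≤ 4) {ε : ℝ} (hε : 0 < ε) :
    ∃ z : ℍ, dist z (g • z) < ε := by
  have hdet := sl_det_eq g
  obtain ⟨δ, hδ, hδε⟩ : ∃ δ : ℝ, 0 < δ ∧ δ ^ 2 / 2 < Real.cosh ε - 1 := by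
    have h1 : 0 < Real.cosh ε - 1 := sub_pos.2 (Real.one_lt_cosh.2 hε.ne')
    refine ⟨√(Real.cosh ε - 1), Real.sqrt_pos.2 h1, ?_⟩
    rw [Real.sq_sqrt h1.le]; linarith
  -- By the displacement formula it is enough to make the fixed-point polynomial small compared with
  -- Im z.
  suffices h : ∃ z : ℍ, ‖(g 1 0 : ℂ) * z ^ 2 + (g 1 1 - g 0 0) * z - g 0 1‖ ≤ δ * z.im by
    obtain ⟨z, hz⟩ := h
    refine ⟨z, ?_⟩
    have hy := z.im_pos
    have h1 : Real.cosh (dist z (g • z)) < Real.cosh ε := by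
      rw [cosh_dist_smul]
      have h2 := pow_le_pow_left₀ (norm_nonneg _) hz 2
      have h3 : ‖(g 1 0 : ℂ) * z ^ 2 + (g 1 1 - g 0 0) * z - g 0 1‖ ^ 2 / (2 * z.im ^ 2) ≤
          δ ^ 2 / 2 := by
        rw [div_le_iff₀ (by positivity)]
        linarith
      linarith
    rw [Real.cosh_lt_cosh, abs_of_nonneg dist_nonneg, abs_of_pos hε] at h1
    exact h1
  by_cases hc : g 1 0 = 0
  · rw [hc, mul_zero, sub_zero] at hdet
    have had : g 1 1 = g 0 0 := by
      have : (g 0 0 - g 1 1) ^ 2 ≤ 0 := by linarith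
      have := pow_eq_zero_iff two_ne_zero |>.1 (le_antisymm this (sq_nonneg _))
      linarith
    -- Here g is a translation, and a point high enough is moved little.
    have hy : 0 < |g 0 1| / δ + 1 := by positivity
    refine ⟨⟨⟨0, |g 0 1| / δ + 1⟩, hy⟩, ?_⟩
    have : δ * (|g 0 1| / δ + 1) = |g 0 1| + δ := by field_simp
    rw [hc, had]
    simp only [UpperHalfPlane.mk_im, this]
    simp [hδ.le]
  · have hc' : 0 < |g 1 0| := abs_pos.2 hc
    -- The roots of the fixed-point polynomial are (a - d)/(2c) ± i s. Raising the upper root by η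
    -- stays in ℍ even when s = 0.
    set s := √(4 - (g 0 0 + g 1 1) ^ 2) / (2 * |g 1 0|) with hs
    set η := δ / (2 * |g 1 0|) with hη
    have hs0 : 0 ≤ s := by positivity
    have hη0 : 0 < η := by positivity
    have hs2 : s ^ 2 * (4 * g 1 0 ^ 2) = 4 - (g 0 0 + g 1 1) ^ 2 := by
      rw [hs, div_pow, Real.sq_sqrt (by linarith), mul_pow, sq_abs]
      field_simp
      ring
    refine ⟨⟨⟨(g 0 0 - g 1 1) / (2 * g 1 0), s + η⟩, by positivity⟩, ?_⟩
    have hval : (g 1 0 : ℂ) * (⟨(g 0 0 - g 1 1) / (2 * g 1 0), s + η⟩ : ℂ) ^ 2 +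
        (g 1 1 - g 0 0) * (⟨(g 0 0 - g 1 1) / (2 * g 1 0), s + η⟩ : ℂ) - g 0 1 =
        ((-(g 1 0 * η * (2 * s + η)) : ℝ) : ℂ) := by
      have hz : (⟨(g 0 0 - g 1 1) / (2 * g 1 0), s + η⟩ : ℂ) =
          (((g 0 0 - g 1 1) / (2 * g 1 0) : ℝ) : ℂ) + ((s + η : ℝ) : ℂ) * Complex.I := by
        rw [Complex.mk_eq_add_mul_I]
      have h4 : g 1 0 * (((g 0 0 - g 1 1) / (2 * g 1 0)) ^ 2 - (s + η) ^ 2) +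
          (g 1 1 - g 0 0) * ((g 0 0 - g 1 1) / (2 * g 1 0)) - g 0 1 =
          -(g 1 0 * η * (2 * s + η)) := by
        field_simp
        linear_combination -hs2 + 4 * hdet
      have h5 : g 1 0 * (2 * ((g 0 0 - g 1 1) / (2 * g 1 0))) + (g 1 1 - g 0 0) = 0 := by
        field_simp; ring
      rw [hz, ← h4]
      have h5' := congrArg (fun r : ℝ => (r : ℂ)) h5
      simp only [Complex.ofReal_zero] at h5'
      set X := (g 0 0 - g 1 1) / (2 * g 1 0)
      push_cast at h5' ⊢
      linear_combination ((s + η) * Complex.I) * h5' + (g 1 0 * (s + η) ^ 2) * Complex.I_sq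
    simp only [UpperHalfPlane.mk_im]
    rw [hval, Complex.norm_real, Real.norm_eq_abs, abs_neg, abs_mul, abs_mul,
      abs_of_pos hη0, abs_of_pos (by positivity : 0 < 2 * s + η)]
    have : |g 1 0| * η = δ / 2 := by rw [hη]; field_simp
    rw [this]
    nlinarith

/-- The matrix with the given entries. -/
def slMk (a b c d : ℝ) (h : a * d - b * c = 1) : SL(2, ℝ) :=
  ⟨!![a, b; c, d], by rw [Matrix.det_fin_two_of, h]⟩

section slMk

variable {a b c d : ℝ} (h : a * d - b * c = 1)

theorem slMk_zero_zero : slMk a b c d h 0 0 = a := rfl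

theorem slMk_zero_one : slMk a b c d h 0 1 = b := rfl

theorem slMk_one_zero : slMk a b c d h 1 0 = c := rfl

theorem slMk_one_one : slMk a b c d h 1 1 = d := rfl

end slMk

theorem sl_ext {g h : SL(2, ℝ)} (h00 : g 0 0 = h 0 0) (h01 : g 0 1 = h 0 1)
    (h10 : g 1 0 = h 1 0) (h11 : g 1 1 = h 1 1) : g = h := by
  apply Matrix.SpecialLinearGroup.ext
  intro i j
  fin_cases i <;> fin_cases j <;> assumption

theorem sl_mul_apply (g h : SL(2, ℝ)) (i j : Fin 2) :
    (g * h) i j = g i 0 * h 0 j + g i 1 * h 1 j := by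
  rw [Matrix.SpecialLinearGroup.coe_mul, Matrix.mul_apply, Fin.sum_univ_two]

theorem coe_slMk_diagonal_smul {a d : ℝ} (h : a * d - 0 * 0 = 1) (w : ℍ) :
    ((slMk a 0 0 d h • w : ℍ) : ℂ) = ((a ^ 2 : ℝ) : ℂ) * w := by
  have h' : (a : ℂ) * d = 1 := by
    rw [← Complex.ofReal_mul]
    rw [mul_zero, sub_zero] at h
    rw [h, Complex.ofReal_one]
  rw [coe_sl_smul, slMk_zero_zero, slMk_zero_one, slMk_one_zero, slMk_one_one,
    Complex.ofReal_zero, zero_mul, zero_add, add_zero, div_eq_iff (right_ne_zero_of_mul_eq_one h')]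
  push_cast
  linear_combination (-(a : ℂ) * w) * h'

theorem exists_scaling (u : ℝ) :
    ∃ S : SL(2, ℝ), ∀ w : ℍ, ((S • w : ℍ) : ℂ) = Real.exp u * w := by
  refine ⟨slMk (Real.exp (u / 2)) 0 0 (Real.exp (-(u / 2))) (by rw [← Real.exp_add]; simp),
    fun w => ?_⟩
  rw [coe_slMk_diagonal_smul, ← Real.exp_nat_mul]
  congr 3; push_cast; ring

theorem exists_eigenvector {g : SL(2, ℝ)} {μ : ℝ} (h : μ ^ 2 - (g 0 0 + g 1 1) * μ + 1 = 0) :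
    ∃ v : Fin 2 → ℝ, v ≠ 0 ∧ g 0 0 * v 0 + g 0 1 * v 1 = μ * v 0 ∧
      g 1 0 * v 0 + g 1 1 * v 1 = μ * v 1 := by
  have hdet := sl_det_eq g
  obtain ⟨v, hv, hm⟩ := (Matrix.exists_mulVec_eq_zero_iff
    (M := !![g 0 0 - μ, g 0 1; g 1 0, g 1 1 - μ])).2 (by
      rw [Matrix.det_fin_two_of]; linear_combination h + hdet)
  have h0 := congrFun hm 0
  have h1 := congrFun hm 1
  simp [Matrix.mulVec, dotProduct, Fin.sum_univ_two] at h0 h1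
  exact ⟨v, hv, by linarith, by linarith⟩

/-- A hyperbolic element of `SL(2, ℝ)` is conjugate to a dilation. -/
theorem exists_conj_dilation {g : SL(2, ℝ)} (htr : 4 < (g 0 0 + g 1 1) ^ 2) :
    ∃ (h : SL(2, ℝ)) (l : ℝ), 0 < l ∧
      ∀ w : ℍ, (((h⁻¹ * g * h) • w : ℍ) : ℂ) = Real.exp l * w := by
  set T := g 0 0 + g 1 1 with hT
  -- The eigenvalue of larger absolute value; its sign is that of the trace and disappears in the
  -- dilation factor μ².
  obtain ⟨μ, hμ, hμ1⟩ : ∃ μ : ℝ, μ ^ 2 - T * μ + 1 = 0 ∧ 1 < μ ^ 2 := by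
    have hr : 0 < √(T ^ 2 - 4) := Real.sqrt_pos.2 (by linarith)
    have hr2 : √(T ^ 2 - 4) ^ 2 = T ^ 2 - 4 := Real.sq_sqrt (by linarith)
    rcases le_total 0 T with h | h
    · refine ⟨(T + √(T ^ 2 - 4)) / 2, by linear_combination hr2 / 4, ?_⟩
      have : 0 ≤ T * √(T ^ 2 - 4) := mul_nonneg h hr.le
      nlinarith
    · refine ⟨(T - √(T ^ 2 - 4)) / 2, by linear_combination hr2 / 4, ?_⟩
      have : T * √(T ^ 2 - 4) ≤ 0 := mul_nonpos_of_nonpos_of_nonneg h hr.le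
      nlinarith
  set ν := T - μ with hν
  have hμν : μ * ν = 1 := by rw [hν]; linear_combination -hμ
  have hne : μ - ν ≠ 0 := by
    intro h
    have : μ = ν := sub_eq_zero.1 h
    rw [← this] at hμν
    nlinarith
  obtain ⟨v, hv, v1, v2⟩ := exists_eigenvector hμ
  obtain ⟨u, hu, u1, u2⟩ := exists_eigenvector (g := g) (μ := ν) (by
    rw [← hT, hν]; linear_combination hμ)
  set K := v 0 * u 1 - v 1 * u 0 with hK
  -- Eigenvectors for distinct eigenvalues are independent: if K = 0, every product of a coordinate
  -- of v with one of u vanishes.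
  have hK0 : K ≠ 0 := by
    intro h0
    have e00 : v 0 * u 0 = 0 := by
      apply (mul_eq_zero.1 _).resolve_left hne
      linear_combination u 0 * (-v1) + v 0 * u1 - g 0 1 * h0
    have e11 : v 1 * u 1 = 0 := by
      apply (mul_eq_zero.1 _).resolve_left hne
      linear_combination u 1 * (-v2) + v 1 * u2 + g 1 0 * h0
    have e01 : v 0 * u 1 = 0 := by
      apply (mul_eq_zero.1 _).resolve_left hne
      linear_combination u 1 * (-v1) + v 1 * u1 + (g 0 0 - ν) * h0
    have e10 : v 1 * u 0 = 0 := by linarith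
    have hv' : v 0 ≠ 0 ∨ v 1 ≠ 0 := by
      by_contra! h
      exact hv (funext fun i => by fin_cases i <;> simp [h.1, h.2])
    apply hu
    rcases hv' with h | h
    · funext i
      fin_cases i
      · exact (mul_eq_zero.1 e00).resolve_left h
      · exact (mul_eq_zero.1 e01).resolve_left h
    · funext i
      fin_cases i
      · exact (mul_eq_zero.1 e10).resolve_left h
      · exact (mul_eq_zero.1 e11).resolve_left h
  have hdet : v 0 * (u 1 / K) - u 0 / K * v 1 = 1 := by
    field_simp
    rw [hK]; ring
  have hdet' : μ * ν - 0 * 0 = 1 := by rw [hμν]; ring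
  set h := slMk (v 0) (u 0 / K) (v 1) (u 1 / K) hdet with hh
  set D := slMk μ 0 0 ν hdet' with hDdef
  have hgh : g * h = h * D := by
    apply sl_ext <;> rw [sl_mul_apply, sl_mul_apply, hh, hDdef] <;>
      simp only [slMk_zero_zero, slMk_zero_one, slMk_one_zero, slMk_one_one]
    · linear_combination v1
    · linear_combination u1 / K
    · linear_combination v2
    · linear_combination u2 / K
  have hD : h⁻¹ * g * h = D := by rw [mul_assoc, hgh, inv_mul_cancel_left]
  refine ⟨h, Real.log (μ ^ 2), Real.log_pos hμ1, fun w => ?_⟩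
  rw [hD, hDdef, coe_slMk_diagonal_smul, Real.exp_log (by positivity)]

/-- A further dilation commutes with the first and brings the base point to the unit circle, the
normalization used for the broken geodesic. -/
theorem exists_conj_dilation_norm_eq_one {g : SL(2, ℝ)} (htr : 4 < (g 0 0 + g 1 1) ^ 2) (z : ℍ) :
    ∃ (h : SL(2, ℝ)) (l : ℝ), 0 < l ∧
      (∀ w : ℍ, (((h⁻¹ * g * h) • w : ℍ) : ℂ) = Real.exp l * w) ∧
      ‖((h⁻¹ • z : ℍ) : ℂ)‖ = 1 := by
  obtain ⟨h, l, hl, hact⟩ := exists_conj_dilation htr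
  have hpos : 0 < ‖((h⁻¹ • z : ℍ) : ℂ)‖ := norm_pos_iff.2 (UpperHalfPlane.ne_zero _)
  obtain ⟨S, hS⟩ := exists_scaling (Real.log ‖((h⁻¹ • z : ℍ) : ℂ)‖)
  rw [Real.exp_log hpos] at hS
  have hSi : ∀ w : ℍ, ((S⁻¹ • w : ℍ) : ℂ) = (‖((h⁻¹ • z : ℍ) : ℂ)‖ : ℂ)⁻¹ * w := by
    intro w
    have := hS (S⁻¹ • w)
    rw [smul_inv_smul] at this
    rw [this, inv_mul_cancel_left₀]
    exact Complex.ofReal_ne_zero.2 hpos.ne'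
  refine ⟨h * S, l, hl, fun w => ?_, ?_⟩
  · have : (h * S)⁻¹ * g * (h * S) = S⁻¹ * (h⁻¹ * g * h) * S := by group
    rw [this, mul_smul, mul_smul, hSi, hact, hS]
    have := Complex.ofReal_ne_zero.2 hpos.ne'
    field_simp
  · rw [mul_inv_rev, mul_smul, hSi, norm_mul, norm_inv, Complex.norm_real, norm_norm,
      inv_mul_cancel₀ hpos.ne']

end HyperbolicSurface

/-! ### Invariance of distance and area; the exponential map -/

namespace HyperbolicSurface

instance : IsIsometricSMul PSL(2, ℝ) ℍ where
  isometry_smul γ := by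
    induction γ using QuotientGroup.induction_on with
    | H g => exact isometry_smul ℍ g

instance : SMulInvariantMeasure SL(2, ℝ) ℍ volume where
  measure_preimage_smul g _ hs := measure_preimage_smul_of_nullMeasurableSet
    (G := GL (Fin 2) ℝ) hs.nullMeasurableSet (Matrix.SpecialLinearGroup.toGL g)

instance : SMulInvariantMeasure PSL(2, ℝ) ℍ volume where
  measure_preimage_smul γ s hs := by
    induction γ using QuotientGroup.induction_on with
    | H g => exact SMulInvariantMeasure.measure_preimage_smul g hs

/-- The hyperbolic distance from `z` to `exp_z v` is the norm of `v`. -/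
theorem dist_hexp (z : ℍ) (v : ℂ) : dist z (hexp z v) = ‖v‖ / z.im := by
  have hy := z.im_pos
  set ζ := discPoint z v with hζ
  have hn : ‖ζ‖ < 1 := norm_discPoint_lt_one z v
  have h1 : 1 - ζ ≠ 0 := by
    intro h
    rw [← sub_eq_zero.1 h] at hn
    simp at hn
  have hyc : (z.im : ℂ) ≠ 0 := Complex.ofReal_ne_zero.2 hy.ne'
  have hw : (hexp z v : ℂ) = z.re + z.im * (Complex.I * (1 + ζ) / (1 - ζ)) := rfl
  have hz : (z : ℂ) = z.re + z.im * Complex.I := (UpperHalfPlane.re_add_im z).symm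
  have e1 : (z : ℂ) - hexp z v = -(2 * z.im * Complex.I * ζ) / (1 - ζ) := by
    rw [hw, eq_div_iff h1]
    conv_lhs => rw [hz]
    field_simp
    ring
  have e2 : (hexp z v : ℂ) - (starRingEnd ℂ) (z : ℂ) = (2 * z.im * Complex.I) / (1 - ζ) := by
    rw [hw, eq_div_iff h1]
    conv_lhs => rw [hz]
    simp only [map_add, map_mul, Complex.conj_ofReal, Complex.conj_I]
    field_simp
    ring
  have hnorm : ‖ζ‖ = Real.tanh (‖v‖ / (2 * z.im)) := by
    rw [hζ, discPoint, norm_mul, norm_mul, norm_neg, Complex.norm_I, one_mul, Complex.norm_real,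
      norm_div, Complex.norm_real, norm_norm, Real.norm_eq_abs]
    rcases eq_or_ne v 0 with rfl | hv
    · simp
    · rw [div_self (norm_ne_zero_iff.2 hv), mul_one, abs_of_nonneg]
      rw [Real.tanh_eq_sinh_div_cosh]
      exact div_nonneg (Real.sinh_nonneg_iff.2 (by positivity)) (Real.cosh_pos _).le
  have ht : Real.tanh (dist z (hexp z v) / 2) = ‖ζ‖ := by
    rw [dist_comm, UpperHalfPlane.tanh_half_dist, dist_comm, Complex.dist_eq, Complex.dist_eq,
      e1, e2, neg_div, norm_neg, norm_div, norm_div, norm_mul _ ζ]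
    have h2 : ‖2 * (z.im : ℂ) * Complex.I‖ ≠ 0 := norm_ne_zero_iff.2 (by simp [hy.ne'])
    have h3 : ‖1 - ζ‖ ≠ 0 := norm_ne_zero_iff.2 h1
    rw [div_div_div_cancel_right₀ h3, mul_div_cancel_left₀ _ h2]
  rw [hnorm] at ht
  have := Real.tanh_injective ht
  field_simp at this ⊢
  exact this

/-- The distance from z recovers ‖v‖, and injectivity of the Cayley transform then recovers the
direction. -/
theorem hexp_injective (z : ℍ) : Function.Injective (hexp z) := by
  intro v v' h
  have hnn : ‖v‖ = ‖v'‖ := by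
    have h1 := dist_hexp z v
    rw [h, dist_hexp] at h1
    exact ((div_left_inj' z.im_ne_zero).1 h1).symm
  have key : ∀ ζ : ℂ, ‖ζ‖ < 1 → 1 - ζ ≠ 0 := by
    intro ζ hn h
    rw [← sub_eq_zero.1 h] at hn
    simp at hn
  have hd : discPoint z v = discPoint z v' := by
    have h1 := key _ (norm_discPoint_lt_one z v)
    have h2 := key _ (norm_discPoint_lt_one z v')
    have h3 := congrArg UpperHalfPlane.coe h
    have hyc : (z.im : ℂ) ≠ 0 := Complex.ofReal_ne_zero.2 z.im_ne_zero
    change (z.re : ℂ) + z.im * (Complex.I * (1 + discPoint z v) / (1 - discPoint z v)) =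
      z.re + z.im * (Complex.I * (1 + discPoint z v') / (1 - discPoint z v')) at h3
    have h4 := mul_left_cancel₀ hyc (add_left_cancel h3)
    rw [div_eq_div_iff h1 h2, mul_assoc, mul_assoc] at h4
    have h5 := mul_left_cancel₀ Complex.I_ne_zero h4
    linear_combination h5 / 2
  rcases eq_or_ne v 0 with rfl | hv
  · rw [norm_zero] at hnn
    exact (norm_eq_zero.1 hnn.symm).symm
  · rw [discPoint, discPoint, ← hnn] at hd
    have ht : ((Real.tanh (‖v‖ / (2 * z.im)) : ℝ) : ℂ) ≠ 0 := by
      rw [Complex.ofReal_ne_zero, ← Real.tanh_zero]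
      intro h0
      have := Real.tanh_injective h0
      have h1 : 0 < ‖v‖ / (2 * z.im) :=
        div_pos (norm_pos_iff.2 hv) (mul_pos two_pos z.im_pos)
      exact h1.ne' this
    have h1 := mul_left_cancel₀ (mul_ne_zero (neg_ne_zero.2 Complex.I_ne_zero) ht) hd
    exact (div_left_inj' (Complex.ofReal_ne_zero.2 (norm_ne_zero_iff.2 hv))).1 h1

end HyperbolicSurface

open HyperbolicSurface

/-! ### Displacements of the group and the thin part -/

namespace ClosedHyperbolicSurface

variable (X : ClosedHyperbolicSurface)

theorem proj_eq_iff {z w : ℍ} : X.proj z = X.proj w ↔ ∃ γ ∈ X.Γ, γ • w = z := by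
  rw [proj, proj, Quotient.eq]
  change z ∈ MulAction.orbit X.Γ w ↔ _
  constructor
  · rintro ⟨γ, hγ⟩
    exact ⟨γ, γ.2, hγ⟩
  · rintro ⟨γ, hγ, h⟩
    exact ⟨⟨γ, hγ⟩, h⟩

theorem proj_smul {γ : PSL(2, ℝ)} (hγ : γ ∈ X.Γ) (z : ℍ) : X.proj (γ • z) = X.proj z :=
  X.proj_eq_iff.2 ⟨γ, hγ, rfl⟩

/-- Proper discontinuity for the compact sets {z} and a closed ball about z. This makes minimal
displacements exist. -/
theorem finite_dist_smul_le (z : ℍ) (r : ℝ) :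
    {γ : PSL(2, ℝ) | γ ∈ X.Γ ∧ dist z (γ • z) ≤ r}.Finite := by
  have := X.properlyDiscontinuous
  have h := ProperlyDiscontinuousSMul.finite_disjoint_inter_image (Γ := X.Γ)
    (isCompact_singleton (x := z)) (isCompact_closedBall z r)
  refine (h.image Subtype.val).subset ?_
  rintro γ ⟨hγ, hd⟩
  refine ⟨⟨γ, hγ⟩, ⟨γ • z, ⟨z, rfl, rfl⟩, ?_⟩, rfl⟩
  rwa [Metric.mem_closedBall, dist_comm]

theorem countable_Γ : (X.Γ : Set PSL(2, ℝ)).Countable := by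
  have : (X.Γ : Set PSL(2, ℝ)) = ⋃ n : ℕ, {γ : PSL(2, ℝ) | γ ∈ X.Γ ∧
      dist UpperHalfPlane.I (γ • UpperHalfPlane.I) ≤ n} := by
    ext γ
    simp only [SetLike.mem_coe, Set.mem_iUnion, Set.mem_ofPred_eq, exists_and_left]
    exact ⟨fun h => ⟨h, exists_nat_ge _⟩, fun h => h.1⟩
  rw [this]
  exact Set.countable_iUnion fun n => (X.finite_dist_smul_le _ _).countable

/-- An element of minimal displacement at a point. -/
theorem exists_min_dist_smul {γ : PSL(2, ℝ)} (hγ : γ ∈ X.Γ) (h1 : γ ≠ 1) (z : ℍ) :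
    ∃ γ₀ ∈ X.Γ, γ₀ ≠ 1 ∧ ∀ β ∈ X.Γ, β ≠ 1 → dist z (γ₀ • z) ≤ dist z (β • z) := by
  have hfin : {β : PSL(2, ℝ) | (β ∈ X.Γ ∧ dist z (β • z) ≤ dist z (γ • z)) ∧ β ≠ 1}.Finite :=
    (X.finite_dist_smul_le z (dist z (γ • z))).subset fun β h => h.1
  obtain ⟨γ₀, h0, hmin⟩ := Set.exists_min_image _ (fun β : PSL(2, ℝ) => dist z (β • z)) hfin
    ⟨γ, ⟨hγ, le_rfl⟩, h1⟩
  refine ⟨γ₀, h0.1.1, h0.2, fun β hβ hβ1 => ?_⟩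
  rcases le_total (dist z (β • z)) (dist z (γ • z)) with h | h
  · exact hmin β ⟨⟨hβ, h⟩, hβ1⟩
  · exact h0.1.2.trans h

theorem exists_pos_le_dist_smul_at (z : ℍ) :
    ∃ ε > 0, ∀ γ ∈ X.Γ, γ ≠ 1 → ε ≤ dist z (γ • z) := by
  by_cases h : ∃ γ ∈ X.Γ, γ ≠ 1
  · obtain ⟨γ, hγ, h1⟩ := h
    obtain ⟨γ₀, h0, h01, hmin⟩ := X.exists_min_dist_smul hγ h1 z
    refine ⟨dist z (γ₀ • z), dist_pos.2 fun h => h01 (X.free γ₀ h0 z h.symm), hmin⟩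
  · push Not at h
    exact ⟨1, one_pos, fun γ hγ h1 => absurd (h γ hγ) h1⟩

/-- The displacements of the nontrivial elements of `Γ` are bounded below. -/
theorem exists_pos_le_dist_smul :
    ∃ ε > 0, ∀ γ ∈ X.Γ, γ ≠ 1 → ∀ z : ℍ, ε ≤ dist z (γ • z) := by
  have := X.compact
  choose ε hε hle using X.exists_pos_le_dist_smul_at
  -- Within ε/3 of a point displaced by at least ε the displacement is still at least ε/3; finitely
  -- many such balls cover the compact quotient.
  have hopen : ∀ z, IsOpen (X.proj '' Metric.ball z (ε z / 3)) := by
    intro z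
    have : ContinuousConstSMul X.Γ ℍ :=
      ⟨fun γ => (isometry_smul ℍ (γ : PSL(2, ℝ))).continuous⟩
    exact isOpenMap_quotient_mk'_mul (Γ := X.Γ) _ Metric.isOpen_ball
  obtain ⟨t, ht⟩ := isCompact_univ.elim_finite_subcover _ hopen (by
    intro p _
    obtain ⟨z, rfl⟩ := Quotient.exists_rep p
    exact Set.mem_iUnion.2 ⟨z, z, Metric.mem_ball_self (div_pos (hε z) three_pos), rfl⟩)
  obtain ⟨δ, hδ, hδt⟩ : ∃ δ > 0, ∀ z ∈ t, δ ≤ ε z / 3 := by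
    rcases t.eq_empty_or_nonempty with rfl | hne
    · exact ⟨1, one_pos, by simp⟩
    · obtain ⟨z, hz, hmin⟩ := t.exists_min_image (fun z => ε z / 3) hne
      exact ⟨ε z / 3, div_pos (hε z) three_pos, hmin⟩
  refine ⟨δ, hδ, fun γ hγ h1 w => ?_⟩
  obtain ⟨z, hz, w', hw', hww'⟩ : ∃ z ∈ t, ∃ w' ∈ Metric.ball z (ε z / 3), X.proj w' = X.proj w := by
    have := ht (Set.mem_univ (X.proj w))
    simpa using this
  obtain ⟨β, hβ, hβw⟩ := X.proj_eq_iff.1 hww'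
  have h2 : dist w (γ • w) = dist w' ((β * γ * β⁻¹) • w') := by
    rw [← hβw, mul_smul, mul_smul, inv_smul_smul, dist_smul]
  have h3 := hle z (β * γ * β⁻¹) (X.Γ.mul_mem (X.Γ.mul_mem hβ hγ) (X.Γ.inv_mem hβ)) (by
    intro h
    exact h1 (conj_eq_one_iff.1 h))
  rw [Metric.mem_ball] at hw'
  have h4 : dist z ((β * γ * β⁻¹) • z) ≤ dist w' z + dist w' ((β * γ * β⁻¹) • w') + dist w' z := by
    calc _ ≤ dist z w' + dist w' ((β * γ * β⁻¹) • w') +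
          dist ((β * γ * β⁻¹) • w') ((β * γ * β⁻¹) • z) := dist_triangle4 _ _ _ _
      _ = _ := by rw [dist_smul, dist_comm z]
  rw [h2]
  linarith [hδt z hz]

/-- A point of the thin part is moved by less than `2 R` by some nontrivial element. -/
theorem exists_dist_smul_lt_of_mem_thinPart {R : ℝ} (hR : 0 < R) {z : ℍ}
    (hz : X.proj z ∈ X.thinPart R) : ∃ γ ∈ X.Γ, γ ≠ 1 ∧ dist z (γ • z) < 2 * R := by
  by_contra! hcon
  refine not_le.2 (show X.injRad (X.proj z) < ENNReal.ofReal R from hz) ?_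
  have hinj : Set.InjOn (fun v => X.proj (hexp z v)) (tangentBall z R.toNNReal) := by
    intro v hv w hw hvw
    rw [tangentBall, Set.mem_ofPred_eq, Real.coe_toNNReal R hR.le] at hv hw
    obtain ⟨γ, hγ, h⟩ := X.proj_eq_iff.1 hvw
    have h1 : γ = 1 := by
      by_contra hne
      refine absurd (hcon γ hγ hne) (not_le.2 ?_)
      calc dist z (γ • z) ≤ dist z (hexp z v) + dist (γ • hexp z w) (γ • z) := by
            rw [h]; exact dist_triangle _ _ _
        _ = ‖v‖ / z.im + ‖w‖ / z.im := by rw [dist_smul, dist_comm _ z, dist_hexp, dist_hexp]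
        _ < 2 * R := by linarith
    rw [h1, one_smul] at h
    exact hexp_injective z h.symm
  exact le_iSup₂_of_le R.toNNReal ⟨z, rfl, hinj⟩ le_rfl

end ClosedHyperbolicSurface

/-! ### Area estimates -/

namespace HyperbolicSurface

theorem finite_setOf_quadratic_eq_zero {a b c : ℝ} (h : a ≠ 0 ∨ b ≠ 0) :
    {x : ℝ | a * x ^ 2 + b * x + c = 0}.Finite := by
  have hp : (Polynomial.C a * Polynomial.X ^ 2 + Polynomial.C b * Polynomial.X +
      Polynomial.C c : Polynomial ℝ) ≠ 0 := by
    intro h0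
    have h2 := congrArg (fun p => Polynomial.coeff p 2) h0
    have h1 := congrArg (fun p => Polynomial.coeff p 1) h0
    simp [Polynomial.coeff_C] at h1 h2
    exact h.elim (fun h => h h2) (fun h => h h1)
  refine (Polynomial.finite_setOfPred_isRoot hp).subset fun x hx => ?_
  have heq : a * x ^ 2 + b * x + c = 0 := hx
  change Polynomial.IsRoot _ x
  simpa [Polynomial.IsRoot] using heq

/-- Perpendicular bisectors are null sets. -/
theorem volume_bisector {p q : ℍ} (hpq : p ≠ q) : volume {z : ℍ | dist z p = dist z q} = 0 := by
  set S : Set (ℝ × ℝ) := {u | q.im * ((u.1 - p.re) ^ 2 + u.2 ^ 2 + p.im ^ 2) =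
    p.im * ((u.1 - q.re) ^ 2 + u.2 ^ 2 + q.im ^ 2)} with hS
  have hSm : MeasurableSet S := measurableSet_eq_fun (by fun_prop) (by fun_prop)
  have hS0 : (volume : Measure (ℝ × ℝ)) S = 0 := by
    rw [Measure.volume_eq_prod, Measure.prod_apply_symm hSm]
    -- The bisector is a conic, and each horizontal slice is the zero set of a nonzero polynomial of
    -- degree at most two.
    refine (lintegral_congr fun y => ?_).trans lintegral_zero
    apply Set.Finite.measure_zero
    refine (finite_setOf_quadratic_eq_zero (a := q.im - p.im)
      (b := 2 * (p.im * q.re - q.im * p.re))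
      (c := q.im * (p.re ^ 2 + y ^ 2 + p.im ^ 2) - p.im * (q.re ^ 2 + y ^ 2 + q.im ^ 2))
      ?_).subset ?_
    · by_contra! hcon
      have him : q.im = p.im := sub_eq_zero.1 hcon.1
      have h2 := hcon.2
      rw [him, ← mul_sub] at h2
      have h3 := (mul_eq_zero.1 ((mul_eq_zero.1 h2).resolve_left two_ne_zero)).resolve_left
        p.im_ne_zero
      exact hpq (UpperHalfPlane.ext_re_im (sub_eq_zero.1 h3).symm him.symm)
    · intro x hx
      have hx' : q.im * ((x - p.re) ^ 2 + y ^ 2 + p.im ^ 2) =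
        p.im * ((x - q.re) ^ 2 + y ^ 2 + q.im ^ 2) := hx
      change _ = _
      linear_combination hx'
  have hC : (volume : Measure ℂ) (Complex.measurableEquivRealProd ⁻¹' S) = 0 := by
    rw [Complex.volume_preserving_equiv_real_prod.measure_preimage hSm.nullMeasurableSet, hS0]
  rw [UpperHalfPlane.volume_eq_lintegral]
  apply setLIntegral_measure_zero
  refine measure_mono_null ?_ hC
  rintro _ ⟨z, hz, rfl⟩
  have h : dist z p = dist z q := hz
  have h1 := congrArg Real.cosh h
  rw [UpperHalfPlane.cosh_dist', UpperHalfPlane.cosh_dist'] at h1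
  have := z.im_pos
  have := p.im_pos
  have := q.im_pos
  rw [div_eq_div_iff (by positivity) (by positivity)] at h1
  change q.im * ((z.re - p.re) ^ 2 + z.im ^ 2 + p.im ^ 2) =
    p.im * ((z.re - q.re) ^ 2 + z.im ^ 2 + q.im ^ 2)
  apply mul_left_cancel₀ (mul_ne_zero two_ne_zero z.im_ne_zero)
  linear_combination h1

/-- A fundamental domain of `w ↦ e ^ l w` on a neighbourhood of the imaginary axis. -/
def strip (K l : ℝ) : Set ℍ := {w | (1 ≤ w.im ∧ w.im < Real.exp l) ∧ |w.re| ≤ K * w.im}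

theorem measurableSet_strip (K l : ℝ) : MeasurableSet (strip K l) := by
  have hi : Measurable UpperHalfPlane.im := UpperHalfPlane.continuous_im.measurable
  have hr : Measurable UpperHalfPlane.re := UpperHalfPlane.continuous_re.measurable
  exact ((measurableSet_le measurable_const hi).inter (measurableSet_lt hi measurable_const)).inter
    (measurableSet_le hr.abs (hi.const_mul K))

/-- Where Im w ≥ 1 the hyperbolic density is at most 1, so the Euclidean area of an enclosing
rectangle suffices. The factor e^l - 1 is of order l for small l and will cancel the 1/l in K. -/
theorem volume_strip_le {K l : ℝ} (hK : 0 ≤ K) :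
    volume (strip K l) ≤ ENNReal.ofReal (2 * K * Real.exp l * (Real.exp l - 1)) := by
  set B : Set (ℝ × ℝ) := Set.Icc (-(K * Real.exp l)) (K * Real.exp l) ×ˢ Set.Ico 1 (Real.exp l)
  have hBm : MeasurableSet B := measurableSet_Icc.prod measurableSet_Ico
  rw [UpperHalfPlane.volume_eq_lintegral]
  have hmeas : MeasurableSet (UpperHalfPlane.coe '' strip K l) :=
    UpperHalfPlane.measurableEmbedding_coe.measurableSet_image.2 (measurableSet_strip K l)
  calc _ ≤ ∫⁻ _ in UpperHalfPlane.coe '' strip K l, (1 : ℝ≥0∞) := by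
        refine setLIntegral_mono' hmeas ?_
        rintro _ ⟨w, hw, rfl⟩
        have h1 : (1 : ℝ≥0) ≤ ‖(w : ℂ).im‖₊ := by
          rw [← NNReal.coe_le_coe, NNReal.coe_one, coe_nnnorm, Real.norm_eq_abs]
          exact hw.1.1.trans (le_abs_self _)
        norm_cast
        apply pow_le_one₀ (by positivity)
        rw [one_div]
        exact inv_le_one_of_one_le₀ h1
    _ = volume (UpperHalfPlane.coe '' strip K l) := by simp
    _ ≤ volume (Complex.measurableEquivRealProd ⁻¹' B) := by
        apply measure_mono
        rintro _ ⟨w, ⟨⟨h1, h2⟩, h3⟩, rfl⟩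
        have h4 : |w.re| ≤ K * Real.exp l := h3.trans (by gcongr)
        exact ⟨abs_le.1 h4, h1, h2⟩
    _ = volume B := Complex.volume_preserving_equiv_real_prod.measure_preimage
        hBm.nullMeasurableSet
    _ = _ := by
        rw [Measure.volume_eq_prod, Measure.prod_prod, Real.volume_Icc, Real.volume_Ico,
          ← ENNReal.ofReal_mul (by
            have := Real.exp_pos l
            have : 0 ≤ K * Real.exp l := by positivity
            linarith)]
        congr 1; ring

end HyperbolicSurface

/-! ### Axes, collars and the area of the thin part -/

namespace ClosedHyperbolicSurface

variable (X : ClosedHyperbolicSurface)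

theorem measurableSet_dirichletDomain : MeasurableSet X.dirichletDomain := by
  have : X.dirichletDomain = ⋂ γ ∈ X.Γ,
      {z : ℍ | dist z UpperHalfPlane.I ≤ dist z (γ • UpperHalfPlane.I)} := by
    ext z
    simp [dirichletDomain]
  rw [this]
  exact (isClosed_biInter fun γ _ => isClosed_le (by fun_prop) (by fun_prop)).measurableSet

/-- The part of the Dirichlet domain equivalent to a point of `F` has at most the area of `F`. -/
theorem volume_dirichletDomain_inter_le {F : Set ℍ} (hF : MeasurableSet F) :
    volume (X.dirichletDomain ∩ {z | ∃ γ ∈ X.Γ, γ • z ∈ F}) ≤ volume F := by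
  have : Countable X.Γ := X.countable_Γ.to_subtype
  have hcont : ∀ γ : PSL(2, ℝ), Measurable fun z : ℍ => γ • z := fun γ =>
    (isometry_smul ℍ γ).continuous.measurable
  set P : X.Γ → Set ℍ := fun γ =>
    (fun z => (γ : PSL(2, ℝ))⁻¹ • z) ⁻¹' X.dirichletDomain ∩ F with hP
  have hPm : ∀ γ, MeasurableSet (P γ) := fun γ =>
    (hcont _ X.measurableSet_dirichletDomain).inter hF
  -- Two translates of the Dirichlet domain meet only on the bisector of the corresponding
  -- translates of i.
  have hdisj : Pairwise (Function.onFun (AEDisjoint volume) P) := by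
    intro γ β hne
    have hI : (γ : PSL(2, ℝ)) • UpperHalfPlane.I ≠ (β : PSL(2, ℝ)) • UpperHalfPlane.I := by
      intro h
      apply hne
      have h1 := X.free _ (X.Γ.mul_mem (X.Γ.inv_mem β.2) γ.2) UpperHalfPlane.I (by
        rw [mul_smul, h, inv_smul_smul])
      exact Subtype.ext (inv_mul_eq_one.1 h1).symm
    have key : ∀ (γ β : X.Γ) (z : ℍ), (γ : PSL(2, ℝ))⁻¹ • z ∈ X.dirichletDomain →
        dist z ((γ : PSL(2, ℝ)) • UpperHalfPlane.I) ≤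
          dist z ((β : PSL(2, ℝ)) • UpperHalfPlane.I) := by
      intro γ β z hz
      have h1 := hz _ (X.Γ.mul_mem (X.Γ.inv_mem γ.2) β.2)
      rw [← dist_smul (γ : PSL(2, ℝ)), ← dist_smul (γ : PSL(2, ℝ)) (_ • z), smul_inv_smul,
        smul_smul, mul_inv_cancel_left] at h1
      exact h1
    refine measure_mono_null ?_ (volume_bisector hI)
    rintro z ⟨⟨h1, -⟩, ⟨h2, -⟩⟩
    exact le_antisymm (key γ β z h1) (key β γ z h2)
  calc _ ≤ volume (⋃ γ : X.Γ, X.dirichletDomain ∩ (fun z => (γ : PSL(2, ℝ)) • z) ⁻¹' F) := by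
        apply measure_mono
        rintro z ⟨hz, γ, hγ, hzF⟩
        exact Set.mem_iUnion.2 ⟨⟨γ, hγ⟩, hz, hzF⟩
    _ ≤ ∑' γ : X.Γ, volume (X.dirichletDomain ∩ (fun z => (γ : PSL(2, ℝ)) • z) ⁻¹' F) :=
        measure_iUnion_le _
    _ = ∑' γ : X.Γ, volume (P γ) := by
        refine tsum_congr fun γ => ?_
        rw [← SMulInvariantMeasure.measure_preimage_smul (γ : PSL(2, ℝ))⁻¹
          (X.measurableSet_dirichletDomain.inter (hcont γ hF)), Set.preimage_inter,
          ← Set.preimage_comp]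
        congr 2
        ext z
        simp
    _ = volume (⋃ γ, P γ) := (measure_iUnion₀ hdisj fun γ => (hPm γ).nullMeasurableSet).symm
    _ ≤ volume F := measure_mono (Set.iUnion_subset fun γ => Set.inter_subset_right)

/-- `t ↦ h (i e ^ t)` is the axis of the element `h D h⁻¹` of `Γ` of translation length `l`, and
projects to a simple closed geodesic. -/
structure IsSimpleAxis (h D : SL(2, ℝ)) (l : ℝ) : Prop where
  mem : (QuotientGroup.mk (h * D * h⁻¹) : PSL(2, ℝ)) ∈ X.Γ
  pos : 0 < l
  coe_smul : ∀ w : ℍ, ((D • w : ℍ) : ℂ) = Real.exp l * w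
  injOn : Set.InjOn (fun t => X.proj (h • iexp t)) (Set.Ico 0 l)

/-- The trace on the surface of the geodesic `t ↦ h (i e ^ t)`. -/
def trace (h : SL(2, ℝ)) : Set X.Point := Set.range fun t => X.proj (h • iexp t)

variable {X}

theorem IsSimpleAxis.smul_iexp {h D : SL(2, ℝ)} {l : ℝ} (H : X.IsSimpleAxis h D l) (t : ℝ) :
    D • iexp t = iexp (t + l) := by
  apply UpperHalfPlane.ext
  rw [H.coe_smul, coe_iexp, coe_iexp, Real.exp_add]
  push_cast; ring

theorem IsSimpleAxis.isSimpleClosedGeodesic {h D : SL(2, ℝ)} {l : ℝ} (H : X.IsSimpleAxis h D l) :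
    X.IsSimpleClosedGeodesic (X.trace h) l := by
  refine ⟨H.pos, fun t => h • iexp t, (isometry_smul ℍ h).comp isometry_iexp, fun t => ?_,
    H.injOn, rfl⟩
  have h1 := X.proj_smul H.mem (h • iexp t)
  rw [psl_mk_smul, mul_smul, inv_smul_smul, mul_smul, H.smul_iexp] at h1
  exact h1

/-- The length l is the displacement at a point of the axis, so the uniform lower bound on
displacements applies. -/
theorem IsSimpleAxis.exists_pos_le : ∃ ε > 0, ∀ {h D : SL(2, ℝ)} {l : ℝ},
    X.IsSimpleAxis h D l → ε ≤ l := by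
  obtain ⟨ε, hε, hle⟩ := X.exists_pos_le_dist_smul
  refine ⟨ε, hε, fun {h D l} H => ?_⟩
  have hd : dist (h • iexp 0)
      ((QuotientGroup.mk (h * D * h⁻¹) : PSL(2, ℝ)) • h • iexp 0) = l := by
    rw [psl_mk_smul, mul_smul, inv_smul_smul, mul_smul, H.smul_iexp, dist_smul,
      isometry_iexp.dist_eq, Real.dist_eq, abs_sub_comm, zero_add, sub_zero, abs_of_pos H.pos]
  rw [← hd]
  refine hle _ H.mem (fun h1 => ?_) _
  rw [h1, one_smul, dist_self] at hd
  exact H.pos.ne hd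

/-- A point moved by less than `2 R` by the element with the given axis is close to the axis. -/
theorem IsSimpleAxis.exists_cosh_dist_lt {h D : SL(2, ℝ)} {l R : ℝ} (H : X.IsSimpleAxis h D l)
    {z : ℍ} (hz : dist z ((h * D * h⁻¹) • z) < 2 * R) :
    l ≤ 2 * R ∧ ∃ t, Real.cosh (dist z (h • iexp t)) * (l / 2) < Real.sinh R := by
  set w := h⁻¹ • z with hw
  have hzw : z = h • w := by rw [hw, smul_inv_smul]
  have hd : dist z ((h * D * h⁻¹) • z) = dist w (D • w) := by
    rw [mul_smul, mul_smul, ← hw, hzw, dist_smul]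
  rw [hd] at hz
  have hy := w.im_pos
  have hc := cosh_dist_of_coe_eq_exp_mul (H.coe_smul w)
  set Q := (w.re ^ 2 + w.im ^ 2) / w.im ^ 2 with hQ
  have hQ1 : 1 ≤ Q := by
    rw [hQ, one_le_div (by positivity)]
    nlinarith [sq_nonneg w.re]
  have hl := H.pos
  constructor
  · have h1 : Real.cosh l ≤ Real.cosh (dist w (D • w)) := by
      rw [hc]
      nlinarith [Real.one_le_cosh l]
    rw [Real.cosh_le_cosh, abs_of_pos hl, abs_of_nonneg dist_nonneg] at h1
    linarith
  · have hpos : 0 < ‖(w : ℂ)‖ := norm_pos_iff.2 w.ne_zero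
    have hn : ‖(w : ℂ)‖ ^ 2 = w.re ^ 2 + w.im ^ 2 := by
      rw [norm_eq_sqrt, Real.sq_sqrt (by positivity)]
    -- The foot of the perpendicular from w to the imaginary axis is i|w|.
    refine ⟨Real.log ‖(w : ℂ)‖, ?_⟩
    have hC : Real.cosh (dist z (h • iexp (Real.log ‖(w : ℂ)‖))) = ‖(w : ℂ)‖ / w.im := by
      have e1 : (iexp (Real.log ‖(w : ℂ)‖)).re = 0 := rfl
      have e2 : (iexp (Real.log ‖(w : ℂ)‖)).im = ‖(w : ℂ)‖ := Real.exp_log hpos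
      rw [hzw, dist_smul, UpperHalfPlane.cosh_dist', e1, e2, sub_zero,
        div_eq_div_iff (by positivity) hy.ne']
      linear_combination -w.im * hn
    rw [hC]
    -- With r the distance to the axis, sinh(displacement/2) = cosh r · sinh(l/2).
    have hs : Real.sinh (dist w (D • w) / 2) = ‖(w : ℂ)‖ / w.im * Real.sinh (l / 2) := by
      have s1 : 0 ≤ Real.sinh (dist w (D • w) / 2) :=
        Real.sinh_nonneg_iff.2 (by positivity)
      have s2 : 0 ≤ ‖(w : ℂ)‖ / w.im * Real.sinh (l / 2) :=
        mul_nonneg (by positivity) (Real.sinh_nonneg_iff.2 (by positivity))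
      rw [← sq_eq_sq₀ s1 s2, mul_pow, div_pow, hn, ← hQ]
      have d1 : ∀ u : ℝ, Real.cosh u = 1 + 2 * Real.sinh (u / 2) ^ 2 := by
        intro u
        have := Real.cosh_two_mul (u / 2)
        rw [mul_div_cancel₀ u two_ne_zero, Real.cosh_sq] at this
        linarith
      rw [d1, d1 l] at hc
      linarith
    calc ‖(w : ℂ)‖ / w.im * (l / 2) ≤ ‖(w : ℂ)‖ / w.im * Real.sinh (l / 2) := by
          gcongr
          exact Real.self_le_sinh_iff.2 (by positivity)
      _ = Real.sinh (dist w (D • w) / 2) := hs.symm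
      _ < Real.sinh R := Real.sinh_lt_sinh.2 (by linarith)

/-- A point close to an axis is equivalent to a point of the corresponding strip. -/
theorem IsSimpleAxis.exists_smul_mem_strip {h D : SL(2, ℝ)} {l K : ℝ} (H : X.IsSimpleAxis h D l)
    {z : ℍ} {t : ℝ} (hz : Real.cosh (dist z (h • iexp t)) ≤ K) :
    ∃ γ ∈ X.Γ, h⁻¹ • γ • z ∈ strip K l := by
  set w := h⁻¹ • z with hw
  have hzw : z = h • w := by rw [hw, smul_inv_smul]
  have hy := w.im_pos
  obtain ⟨k, hk⟩ := exists_add_zsmul_mem_Ico H.pos (Real.log w.im)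
  refine ⟨(QuotientGroup.mk (h * D * h⁻¹) : PSL(2, ℝ)) ^ k, X.Γ.zpow_mem H.mem k, ?_⟩
  have hact : h⁻¹ • (QuotientGroup.mk (h * D * h⁻¹) : PSL(2, ℝ)) ^ k • z = D ^ k • w := by
    rw [← QuotientGroup.mk_zpow, psl_mk_smul, conj_zpow, mul_smul, mul_smul, inv_smul_smul]
  have hDw := coe_zpow_smul H.coe_smul k w
  have hre : (D ^ k • w).re = Real.exp (k * l) * w.re := by
    have := congrArg Complex.re hDw
    rwa [Complex.re_ofReal_mul] at this
  have him : (D ^ k • w).im = Real.exp (k * l) * w.im := by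
    have := congrArg Complex.im hDw
    rwa [Complex.im_ofReal_mul] at this
  have him' : (D ^ k • w).im = Real.exp (Real.log w.im + k * l) := by
    rw [him, Real.exp_add, Real.exp_log hy, mul_comm]
  -- This cone is invariant under dilations, so the power k only has to adjust the height.
  have hK : |w.re| ≤ K * w.im := by
    have e1 : (iexp t).re = 0 := rfl
    have e2 : (iexp t).im = Real.exp t := rfl
    have hE := Real.exp_pos t
    rw [hzw, dist_smul, UpperHalfPlane.cosh_dist', e1, e2, sub_zero,
      div_le_iff₀ (by positivity)] at hz
    have h1 : 2 * |w.re| * Real.exp t ≤ w.re ^ 2 + Real.exp t ^ 2 := by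
      nlinarith [sq_nonneg (|w.re| - Real.exp t), sq_abs w.re]
    have h2 : |w.re| * (2 * Real.exp t) ≤ K * w.im * (2 * Real.exp t) := by
      nlinarith [sq_nonneg w.im]
    exact le_of_mul_le_mul_right h2 (by positivity)
  rw [hact]
  refine ⟨⟨?_, ?_⟩, ?_⟩
  · rw [him']; exact Real.one_le_exp hk.1
  · rw [him']; exact Real.exp_lt_exp.2 hk.2
  · rw [hre, him, abs_mul, abs_of_pos (Real.exp_pos _)]
    have := mul_le_mul_of_nonneg_left hK (Real.exp_pos (k * l)).le
    linarith

variable (X)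

/-- Nontrivial elements of `Γ` are hyperbolic. -/
theorem four_lt_trace_sq {g : SL(2, ℝ)} (hg : (QuotientGroup.mk g : PSL(2, ℝ)) ∈ X.Γ)
    (h1 : (QuotientGroup.mk g : PSL(2, ℝ)) ≠ 1) : 4 < (g 0 0 + g 1 1) ^ 2 := by
  by_contra! hcon
  obtain ⟨ε, hε, hle⟩ := X.exists_pos_le_dist_smul
  obtain ⟨z, hz⟩ := exists_dist_smul_lt hcon hε
  exact absurd (hle _ hg h1 z) (not_le.2 hz)

/-- The preimage of the conjugate `h⁻¹ Γ h` in `SL(2, ℝ)`. -/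
def conjLift (h : SL(2, ℝ)) : Subgroup SL(2, ℝ) :=
  (X.Γ.comap (QuotientGroup.mk' _)).comap (MulAut.conj h).toMonoidHom

theorem mem_conjLift {h b : SL(2, ℝ)} :
    b ∈ X.conjLift h ↔ (QuotientGroup.mk (h * b * h⁻¹) : PSL(2, ℝ)) ∈ X.Γ := Iff.rfl

theorem conj_mem_conjLift {h b : SL(2, ℝ)} (hb : (QuotientGroup.mk b : PSL(2, ℝ)) ∈ X.Γ) :
    h⁻¹ * b * h ∈ X.conjLift h := by
  rw [mem_conjLift]
  have : h * (h⁻¹ * b * h) * h⁻¹ = b := by group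
  rwa [this]

/-- The lift to SL(2, ℝ) contains -1, so freeness can only say that an element with a fixed point
acts trivially. -/
theorem conjLift_free {h b : SL(2, ℝ)} (hb : b ∈ X.conjLift h) {w : ℍ} (hw : b • w = w) (w' : ℍ) :
    b • w' = w' := by
  have h1 := X.free _ (X.mem_conjLift.1 hb) (h • w) (by
    rw [psl_mk_smul, mul_smul, inv_smul_smul, mul_smul, hw])
  have h2 := psl_mk_smul (h * b * h⁻¹) (h • w')
  rw [h1, one_smul, mul_smul, inv_smul_smul, mul_smul] at h2
  exact (smul_left_cancel h h2).symm

theorem dist_inv_smul_smul (h b : SL(2, ℝ)) (z : ℍ) :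
    dist (h⁻¹ • z) (b • h⁻¹ • z) = dist z ((h * b * h⁻¹) • z) := by
  rw [← dist_smul h, smul_inv_smul, mul_smul, mul_smul]

theorem dist_le_of_mem_conjLift {g h b : SL(2, ℝ)} {z : ℍ}
    (hmin : ∀ β ∈ X.Γ, β ≠ 1 → dist z (g • z) ≤ dist z (β • z))
    (hb : b ∈ X.conjLift h) (hbz : b • h⁻¹ • z ≠ h⁻¹ • z) :
    dist (h⁻¹ • z) ((h⁻¹ * g * h) • h⁻¹ • z) ≤ dist (h⁻¹ • z) (b • h⁻¹ • z) := by
  have hconj : h * (h⁻¹ * g * h) * h⁻¹ = g := by group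
  rw [dist_inv_smul_smul, dist_inv_smul_smul, hconj]
  have hle := hmin (QuotientGroup.mk (h * b * h⁻¹)) (X.mem_conjLift.1 hb)
  rw [psl_mk_smul] at hle
  refine hle fun h1 => hbz ?_
  have h2 := psl_mk_smul (h * b * h⁻¹) z
  rw [h1, one_smul, mul_smul, mul_smul] at h2
  exact (inv_smul_eq_iff.2 h2).symm

/-- Through every point of the thin part goes a short loop around a simple closed geodesic. -/
theorem exists_isSimpleAxis {R : ℝ} (hR : 0 < R) {z : ℍ} (hz : X.proj z ∈ X.thinPart R) :
    ∃ (h D : SL(2, ℝ)) (l : ℝ), X.IsSimpleAxis h D l ∧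
      dist z ((h * D * h⁻¹) • z) < 2 * R := by
  obtain ⟨γ₁, hγ₁, hγ₁1, hγ₁R⟩ := X.exists_dist_smul_lt_of_mem_thinPart hR hz
  -- Being short is not enough: minimality at z is what makes the axis simple.
  obtain ⟨γ, hγ, hγ1, hmin⟩ := X.exists_min_dist_smul hγ₁ hγ₁1 z
  obtain ⟨g, rfl⟩ := QuotientGroup.mk_surjective γ
  obtain ⟨h, l, hl, hact, hnorm⟩ :=
    exists_conj_dilation_norm_eq_one (X.four_lt_trace_sq hγ hγ1) z
  have hmem := X.conj_mem_conjLift (h := h) hγ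
  have hconj : h * (h⁻¹ * g * h) * h⁻¹ = g := by group
  refine ⟨h, h⁻¹ * g * h, l, ⟨X.mem_conjLift.1 hmem, hl, hact, ?_⟩, ?_⟩
  · intro s hs t ht hst
    obtain ⟨β, hβ, hβt⟩ := X.proj_eq_iff.1 hst
    obtain ⟨b, rfl⟩ := QuotientGroup.mk_surjective β
    have hbt : (h⁻¹ * b * h) • iexp t = iexp s := by
      rw [psl_mk_smul] at hβt
      rw [mul_smul, mul_smul, hβt, inv_smul_smul]
    exact (eq_of_smul_iexp_eq (fun _ hb _ hw => X.conjLift_free hb hw) hl hact hmem hnorm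
      (fun _ hb hbz => X.dist_le_of_mem_conjLift hmin hb hbz)
      (X.conj_mem_conjLift hβ) ht hs hbt).symm
  · rw [hconj]
    exact (hmin γ₁ hγ₁ hγ₁1).trans_lt hγ₁R

/-- The points moved by less than `2 R` by an element whose axis has the trace `B`. -/
def collar (R : ℝ) (B : Set X.Point) : Set ℍ :=
  {z | ∃ (h D : SL(2, ℝ)) (l : ℝ), X.IsSimpleAxis h D l ∧ X.trace h = B ∧
    dist z ((h * D * h⁻¹) • z) < 2 * R}

theorem volume_dirichletDomain_inter_collar_le {R : ℝ} (hR : 0 < R) (B : Set X.Point) :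
    volume (X.dirichletDomain ∩ X.collar R B) ≤
      ENNReal.ofReal (8 * Real.sinh R * Real.exp (4 * R)) := by
  rcases (X.collar R B).eq_empty_or_nonempty with h0 | ⟨z₀, h₀, D₀, l₀, H₀, hB₀, hz₀⟩
  · simp [h0]
  set A : Set ℝ := {l | l ≤ 2 * R ∧ ∃ h D, X.IsSimpleAxis h D l ∧ X.trace h = B}
  have hA : A.Nonempty := ⟨l₀, (H₀.exists_cosh_dist_lt hz₀).1, h₀, D₀, H₀, hB₀⟩
  obtain ⟨ε, hε, hle⟩ := IsSimpleAxis.exists_pos_le (X := X)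
  have hεA : ∀ l ∈ A, ε ≤ l := fun l ⟨_, h, D, H, _⟩ => hle H
  -- It is not needed that the trace determines l: a length within a factor 2 of the infimum serves
  -- for all presentations of the same trace.
  have hinf : 0 < sInf A := hε.trans_le (le_csInf hA hεA)
  obtain ⟨l, ⟨hlR, h, D, H, hB⟩, hl2⟩ := exists_lt_of_csInf_lt hA
    (show sInf A < 2 * sInf A by linarith)
  have hl := H.pos
  have hsR : 0 < Real.sinh R := Real.sinh_pos_iff.2 hR
  -- The distance r to any of these axes, of length l', satisfies cosh r < 2 sinh R / l', and l < 2
  -- l'.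
  set K := 4 * Real.sinh R / l with hK
  set F : Set ℍ := (fun z => h⁻¹ • z) ⁻¹' strip K l with hF
  have hcont : Measurable fun z : ℍ => h⁻¹ • z := (isometry_smul ℍ h⁻¹).continuous.measurable
  have hsub : X.collar R B ⊆ {z | ∃ γ ∈ X.Γ, γ • z ∈ F} := by
    rintro z ⟨h', D', l', H', hB', hz⟩
    obtain ⟨hl', t, ht⟩ := H'.exists_cosh_dist_lt hz
    have hll' : l < 2 * l' :=
      hl2.trans_le (mul_le_mul_of_nonneg_left (csInf_le ⟨ε, hεA⟩ ⟨hl', h', D', H', hB'⟩)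
        two_pos.le)
    -- Equal traces allow the nearby point of the other axis to be moved by Γ onto the chosen axis.
    obtain ⟨s, hs⟩ : X.proj (h' • iexp t) ∈ X.trace h := by
      rw [hB, ← hB']; exact ⟨t, rfl⟩
    obtain ⟨γ, hγ, hγt⟩ := X.proj_eq_iff.1 hs
    have hcosh : Real.cosh (dist (γ • z) (h • iexp s)) ≤ K := by
      rw [← hγt, dist_smul, hK, le_div_iff₀ hl]
      have := Real.cosh_pos (dist z (h' • iexp t))
      nlinarith
    obtain ⟨β, hβ, hmem⟩ := H.exists_smul_mem_strip hcosh
    exact ⟨β * γ, X.Γ.mul_mem hβ hγ, by rw [mul_smul]; exact hmem⟩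
  have he : Real.exp l - 1 ≤ l * Real.exp l := by
    have h1 := Real.add_one_le_exp (-l)
    rw [Real.exp_neg] at h1
    have h2 := mul_le_mul_of_nonneg_right h1 (Real.exp_pos l).le
    rw [inv_mul_cancel₀ (Real.exp_pos l).ne'] at h2
    linarith
  calc _ ≤ volume (X.dirichletDomain ∩ {z | ∃ γ ∈ X.Γ, γ • z ∈ F}) :=
        measure_mono (Set.inter_subset_inter_right _ hsub)
    _ ≤ volume F := X.volume_dirichletDomain_inter_le (hcont (measurableSet_strip K l))
    _ = volume (strip K l) :=
        SMulInvariantMeasure.measure_preimage_smul h⁻¹ (measurableSet_strip K l)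
    _ ≤ ENNReal.ofReal (2 * K * Real.exp l * (Real.exp l - 1)) := volume_strip_le (by positivity)
    _ ≤ _ := by
        apply ENNReal.ofReal_le_ofReal
        calc 2 * K * Real.exp l * (Real.exp l - 1)
            ≤ 2 * K * Real.exp l * (l * Real.exp l) := by gcongr
          _ = 8 * Real.sinh R * Real.exp (l + l) := by
              rw [hK, Real.exp_add]; field_simp; ring
          _ ≤ 8 * Real.sinh R * Real.exp (4 * R) := by
              gcongr; linarith

/-- The area of the thin part is at most a constant times the number of short simple closed
geodesics. -/
theorem vol_thinPart_le {R : ℝ} (hR : 0 < R) :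
    X.vol (X.thinPart R) ≤ ENNReal.ofReal (8 * Real.sinh R * Real.exp (4 * R)) *
      (X.numSimpleClosedGeodesics (2 * R) : ℝ≥0∞) := by
  have hC : 0 < 8 * Real.sinh R * Real.exp (4 * R) := by
    have := Real.sinh_pos_iff.2 hR
    positivity
  set 𝒢 : Set (Set X.Point) := {A | ∃ L ≤ 2 * R, X.IsSimpleClosedGeodesic A L} with h𝒢
  have hnum : X.numSimpleClosedGeodesics (2 * R) = 𝒢.encard := rfl
  rw [hnum]
  rcases 𝒢.finite_or_infinite with hfin | hinf
  · have hcover : X.dirichletDomain ∩ X.proj ⁻¹' X.thinPart R ⊆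
        ⋃ B ∈ hfin.toFinset, X.dirichletDomain ∩ X.collar R B := by
      rintro z ⟨hzD, hz⟩
      obtain ⟨h, D, l, H, hd⟩ := X.exists_isSimpleAxis hR hz
      refine Set.mem_iUnion₂.2 ⟨X.trace h, ?_, hzD, h, D, l, H, rfl, hd⟩
      rw [Set.Finite.mem_toFinset]
      exact ⟨l, (H.exists_cosh_dist_lt hd).1, H.isSimpleClosedGeodesic⟩
    calc X.vol (X.thinPart R) ≤ volume (⋃ B ∈ hfin.toFinset,
          X.dirichletDomain ∩ X.collar R B) := measure_mono hcover
      _ ≤ ∑ B ∈ hfin.toFinset, volume (X.dirichletDomain ∩ X.collar R B) :=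
          measure_biUnion_finset_le _ _
      _ ≤ ∑ _B ∈ hfin.toFinset, ENNReal.ofReal (8 * Real.sinh R * Real.exp (4 * R)) :=
          Finset.sum_le_sum fun B _ => X.volume_dirichletDomain_inter_collar_le hR B
      _ = _ := by
          rw [Finset.sum_const, nsmul_eq_mul, mul_comm, hfin.encard_eq_coe_toFinset_card]
          simp
  -- Finiteness of the count is not required: with infinitely many geodesics the right side is ∞,
  -- since the constant is positive.
  · rw [hinf.encard_eq, ENat.toENNReal_top, ENNReal.mul_top (ENNReal.ofReal_pos.2 hC).ne']
    exact le_top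

end ClosedHyperbolicSurface

end

theorem mainTheorem3 (X : ℕ → ClosedHyperbolicSurface)
    (hX : ∀ R : ℝ, 0 < R →
      Tendsto (fun n => ((X n).numSimpleClosedGeodesics R : ℝ≥0∞) / (X n).vol Set.univ)
        atTop (𝓝 0)) :
    BenjaminiSchrammConvergent X := by
  intro R hR
  have h := ENNReal.Tendsto.const_mul (hX (2 * R) (by positivity))
    (Or.inr (ENNReal.ofReal_ne_top (r := 8 * Real.sinh R * Real.exp (4 * R))))
  rw [mul_zero] at h
  refine tendsto_of_tendsto_of_tendsto_of_le_of_le tendsto_const_nhds h (fun _ => zero_le)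
    fun n => ?_
  change _ ≤ ENNReal.ofReal (8 * Real.sinh R * Real.exp (4 * R)) *
    (((X n).numSimpleClosedGeodesics (2 * R) : ℝ≥0∞) / (X n).vol Set.univ)
  rw [← mul_div_assoc]
  exact ENNReal.div_le_div_right ((X n).vol_thinPart_le hR) _
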